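/- Let $V$ be a real vector space of finite dimension $m$ with an inner product $h$, let $V_{\mathbb C}=V\otimes_{\mathbb R}\mathbb C$, let $V_{\mathbb C}^*$ be its complex dual, and let $h^*_{\mathbb C}$ be the symmetric complex bilinear form on $V_{\mathbb C}^*$ induced by $h$. Let $1\le n\le m/2$. The orthogonal Grassmannian is the complex manifold $$\mathbb F=\{\Lambda^*\subset V_{\mathbb C}^* \text{ a complex subspace}:\ \dim_{\mathbb C}\Lambda^*=n,\ h^*_{\mathbb C}|_{\Lambda^*\times\Lambda^*}\equiv 0\},$$ a complex submanifold of the Grassmannian of $n$-dimensional subspaces of $V_{\mathbb C}^*$. Let $\mathfrak Q$ be the universal quotient bundle on $\mathbb F$, that is, the holomorphic quotient of $\mathbb F\times V_{\mathbb C}$ whose fibre at $\Lambda^*$ is the quotient $\Lambda$ of $V_{\mathbb C}$ by the common kernel of the functionals in $\Lambda^*$, and let $\mathcal Q$ be its realification, regarded as a quotient of $\mathbb F\times V$, with multiplication by $i$ as almost complex structure. An almost-complex isotropic quotient bundle of rank $2n$ of $M\times V$, where $M$ is a real smooth manifold, is a smooth real vector bundle $E$ of rank $2n$ on $M$ with a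 smooth surjective bundle map $q:M\times V\to E$ and a smooth endomorphism $J$ of $E$ with $J^2=-\mathrm{id}$, such that for every $x\in M$ the form $h^*_{\mathbb C}$ vanishes on the set of the complex-linear extensions to $V_{\mathbb C}$ of the maps $\ell\circ q_x:V\to\mathbb C$, where $\ell$ runs over the complex-linear functionals on $(E_x,J_x)$. An isomorphism of such bundles is an isomorphism of smooth vector bundles over $\mathrm{id}_M$ that commutes with the quotient maps and with the almost complex structures. An isotropic holomorphic quotient bundle of rank $n$ of $N\times V_{\mathbb C}$, where $N$ is a complex manifold, is a holomorphic vector bundle $E$ of rank $n$ on $N$ with a holomorphic surjective bundle map $q:N\times V_{\mathbb C}\to E$ such that for every $x\in N$ the form $h^*_{\mathbb C}$ vanishes on $\{\ell\circ q_x:\ell\in E_x^*\}\subset V_{\mathbb C}^*$; isomorphisms are isomorphisms of holomorphic bundles over $\mathrm{id}_N$ that commute with the quotient maps. 1. The real smooth manifold underlying $\mathbb F$ represents the contravariant functor from the category of real smooth manifolds and smooth maps to sets that sends $M$ to the set of isomorphism classes of almost-complex isotropic quotient bundles of rank $2n$ of $M\times V$ and a smooth map to the pullback; the universal element is the class of $\mathcal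 Q$. 2. The complex manifold $\mathbb F$ represents the contravariant functor from the category of complex manifolds and holomorphic maps to sets that sends $N$ to the set of isomorphism classes of isotropic holomorphic quotient bundles of rank $n$ of $N\times V_{\mathbb C}$ and a holomorphic map to the pullback; the universal element is the class of $\mathfrak Q$. In other words, for every almost-complex isotropic quotient bundle $E$ of rank $2n$ of $M\times V$ there is exactly one smooth map $f:M\to\mathbb F$ with $E\cong f^*\mathcal Q$, and for every isotropic holomorphic quotient bundle $E$ of rank $n$ of $N\times V_{\mathbb C}$ there is exactly one holomorphic map $f:N\to\mathbb F$ with $E\cong f^*\mathfrak Q$. -/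

import Mathlib

open scoped TensorProduct Manifold ContDiff Bundle
open CategoryTheory

noncomputable section

namespace OrthogonalGrassmannian

universe u

/-! ### Linear algebra: the complexification, its dual, and the dual quadratic form -/

section LinearAlgebra

/-- The complex dual `V_ℂ^*` of the complexification `V_ℂ = ℂ ⊗ V` of a real vector space. -/
abbrev CDual (V : Type u) [NormedAddCommGroup V] [InnerProductSpace ℝ V] : Type u :=
  Module.Dual ℂ (ℂ ⊗[ℝ] V)

/-- The symmetric `ℂ`-bilinear form `h_ℂ` on `V_ℂ` obtained from the inner product `h` of `V` by
extension of scalars. -/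
def complexForm (V : Type u) [NormedAddCommGroup V] [InnerProductSpace ℝ V] :
    LinearMap.BilinForm ℂ (ℂ ⊗[ℝ] V) :=
  LinearMap.BilinForm.baseChange ℂ (innerₗ V)

/-- The symmetric `ℂ`-bilinear form `h_ℂ^*` on `V_ℂ^*`: in terms of an orthonormal basis `(e_i)` of
`V`, `h_ℂ^*(α, β) = ∑ i, α(e_i) β(e_i)`. By `dualForm_flat` it is the form that corresponds to
`h_ℂ` under the musical isomorphism `V_ℂ ≃ V_ℂ^*`; in particular it does not depend on the basis. -/
def dualForm (V : Type u) [NormedAddCommGroup V] [InnerProductSpace ℝ V]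
    [FiniteDimensional ℝ V] : LinearMap.BilinForm ℂ (CDual V) :=
  LinearMap.mk₂ ℂ
    (fun α β => ∑ i, α (1 ⊗ₜ[ℝ] stdOrthonormalBasis ℝ V i) * β (1 ⊗ₜ[ℝ] stdOrthonormalBasis ℝ V i))
    (fun α α' β => by simp [add_mul, Finset.sum_add_distrib])
    (fun c α β => by simp [Finset.mul_sum, mul_assoc])
    (fun α β β' => by simp [mul_add, Finset.sum_add_distrib])
    (fun c α β => by simp [Finset.mul_sum, mul_left_comm])

variable {V : Type u} [NormedAddCommGroup V] [InnerProductSpace ℝ V] [FiniteDimensional ℝ V]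

lemma dualForm_apply (α β : CDual V) : dualForm V α β =
    ∑ i, α (1 ⊗ₜ[ℝ] stdOrthonormalBasis ℝ V i) * β (1 ⊗ₜ[ℝ] stdOrthonormalBasis ℝ V i) := rfl

lemma dualForm_comm (α β : CDual V) : dualForm V α β = dualForm V β α := by
  simp [dualForm_apply, mul_comm]

/-- The form `h_ℂ^*` corresponds to `h_ℂ` under the musical isomorphism `x ↦ h_ℂ(x, ·)`. -/
lemma dualForm_flat (x y : ℂ ⊗[ℝ] V) :
    dualForm V (complexForm V x) (complexForm V y) = complexForm V x y := by
  induction x with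
  | zero => simp
  | add a b ha hb => simp [ha, hb]
  | tmul z v =>
    induction y with
    | zero => simp
    | add a b ha hb => simp [ha, hb]
    | tmul w v' =>
      have := (stdOrthonormalBasis ℝ V).sum_inner_mul_inner v v'
      simp only [dualForm_apply, complexForm, LinearMap.BilinForm.baseChange_tmul,
        innerₗ_apply_apply, ← this]
      simp only [mul_one, Algebra.smul_def, map_sum, map_mul, Finset.sum_mul]
      refine Finset.sum_congr rfl fun i _ => ?_
      rw [real_inner_comm v']
      ring

lemma cdual_ext {α β : CDual V} (h : ∀ i, α (1 ⊗ₜ[ℝ] stdOrthonormalBasis ℝ V i) =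
    β (1 ⊗ₜ[ℝ] stdOrthonormalBasis ℝ V i)) : α = β := by
  refine ((stdOrthonormalBasis ℝ V).toBasis.baseChange ℂ).ext fun i => ?_
  simpa using h i

lemma dualForm_nondegenerate (α : CDual V) (h : ∀ β, dualForm V α β = 0) : α = 0 := by
  classical
  refine cdual_ext fun j => ?_
  have := h (((stdOrthonormalBasis ℝ V).toBasis.baseChange ℂ).coord j)
  have h2 : ∀ i, ((stdOrthonormalBasis ℝ V).toBasis.baseChange ℂ).coord j
      (1 ⊗ₜ[ℝ] stdOrthonormalBasis ℝ V i) = if i = j then 1 else 0 := by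
    intro i
    have h3 : (1 : ℂ) ⊗ₜ[ℝ] stdOrthonormalBasis ℝ V i =
      ((stdOrthonormalBasis ℝ V).toBasis.baseChange ℂ) i := by simp
    rw [h3, Module.Basis.coord_apply, Module.Basis.repr_self, Finsupp.single_apply]
  rw [dualForm_apply] at this
  simpa [h2] using this

lemma finrank_cdual : Module.finrank ℂ (CDual V) = Module.finrank ℝ V := by
  rw [Subspace.dual_finrank_eq, Module.finrank_baseChange]

/-- Finitely many linearly independent functionals take prescribed values simultaneously. -/
lemma pi_surjective {X : Type*} [AddCommGroup X] [Module ℂ X] {n : ℕ}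
    (w : Fin n → Module.Dual ℂ X) (hw : LinearIndependent ℂ w) :
    Function.Surjective (LinearMap.pi w) := by
  classical
  rw [← LinearMap.range_eq_top]
  by_contra hne
  obtain ⟨g, hg, hle⟩ := Submodule.exists_le_ker_of_lt_top _ (lt_top_iff_ne_top.2 hne)
  apply hg
  have hsum : ∑ i, g (Pi.single i 1) • w i = 0 := by
    ext x
    have := hle (LinearMap.mem_range_self (LinearMap.pi w) x)
    rw [LinearMap.mem_ker, LinearMap.pi_apply_eq_sum_univ] at this
    have h1 : ∀ i : Fin n, (fun j => if i = j then (1 : ℂ) else 0) = Pi.single i 1 := by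
      intro i; ext j; simp [Pi.single_apply, eq_comm]
    simpa [mul_comm, h1] using this
  have h0 := Fintype.linearIndependent_iff.1 hw _ hsum
  ext i
  simpa using h0 i

end LinearAlgebra

/-! ### The orthogonal Grassmannian and its charts -/

section Grassmannian

/-- The orthogonal Grassmannian `F_n(V^*, h^*)`: the set of `n`-dimensional complex subspaces
`Λ^*` of `V_ℂ^*` on which `h_ℂ^*` vanishes identically. -/
def OG (V : Type u) [NormedAddCommGroup V] [InnerProductSpace ℝ V] [FiniteDimensional ℝ V]
    (n : ℕ) : Type u :=
  {W : Submodule ℂ (CDual V) // Module.finrank ℂ W = n ∧ ∀ α ∈ W, ∀ β ∈ W, dualForm V α β = 0}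

/-- A Witt basis of `V_ℂ^*`: a basis `e_1, …, e_n, f_1, …, f_n, u_1, …, u_{m-2n}` such that the
`e_i` and the `f_i` are isotropic and dual to each other, and orthogonal to the `u_k`. -/
structure WittBasis (V : Type u) [NormedAddCommGroup V] [InnerProductSpace ℝ V]
    [FiniteDimensional ℝ V] (n : ℕ) : Type u where
  basis : Module.Basis (Fin n ⊕ Fin n ⊕ Fin (Module.finrank ℝ V - 2 * n)) ℂ (CDual V)
  form_ee : ∀ i j, dualForm V (basis (.inl i)) (basis (.inl j)) = 0
  form_ff : ∀ i j, dualForm V (basis (.inr (.inl i))) (basis (.inr (.inl j))) = 0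
  form_ef : ∀ i j, dualForm V (basis (.inl i)) (basis (.inr (.inl j))) = if i = j then 1 else 0
  form_eu : ∀ i k, dualForm V (basis (.inl i)) (basis (.inr (.inr k))) = 0
  form_fu : ∀ i k, dualForm V (basis (.inr (.inl i))) (basis (.inr (.inr k))) = 0

/-- The space of skew-symmetric complex `n × n` matrices. -/
def skew (n : ℕ) : Submodule ℂ (Fin n → Fin n → ℂ) where
  carrier := {s | ∀ i j, s i j = - s j i}
  zero_mem' := by intro i j; simp
  add_mem' := by
    intro s t hs ht i j
    simp only [Pi.add_apply]
    rw [hs i j, ht i j]; ring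
  smul_mem' := by
    intro c s hs i j
    simp only [Pi.smul_apply, smul_eq_mul]
    rw [hs i j]; ring

/-- The model space of the orthogonal Grassmannian: pairs of a skew-symmetric `n × n` matrix and
an arbitrary `n × k` matrix, where `k = m - 2n`. -/
abbrev Model (n k : ℕ) : Type := skew n × (Fin n → Fin k → ℂ)

variable {V : Type u} [NormedAddCommGroup V] [InnerProductSpace ℝ V] [FiniteDimensional ℝ V]
  {n : ℕ}

namespace WittBasis

/-- The vectors `e_i` of a Witt basis. -/
def e (b : WittBasis V n) (i : Fin n) : CDual V := b.basis (.inl i)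

/-- The vectors `f_i` of a Witt basis. -/
def f (b : WittBasis V n) (i : Fin n) : CDual V := b.basis (.inr (.inl i))

/-- The vectors `u_k` of a Witt basis. -/
def u (b : WittBasis V n) (k : Fin (Module.finrank ℝ V - 2 * n)) : CDual V :=
  b.basis (.inr (.inr k))

/-- The matrix `s - (1/2) B G Bᵀ`, with `G` the Gram matrix of the `u_k`. -/
def quad (b : WittBasis V n) (p : Model n (Module.finrank ℝ V - 2 * n)) (i j : Fin n) : ℂ :=
  (p.1 : Fin n → Fin n → ℂ) i j
    - 2⁻¹ * ∑ k, ∑ l, p.2 i k * dualForm V (b.u k) (b.u l) * p.2 j l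

/-- The frame `w_i = e_i + ∑ j, a_ij f_j + ∑ k, B_ik u_k`, where `a = s - (1/2) B G Bᵀ`. Its span is
the graph of a linear map from the span of the `e_i` to the span of the `f_j` and the `u_k`; the
isotropic graphs are exactly those of this form. -/
def frame (b : WittBasis V n) (p : Model n (Module.finrank ℝ V - 2 * n)) (i : Fin n) : CDual V :=
  b.e i + ∑ j, b.quad p i j • b.f j + ∑ k, p.2 i k • b.u k

variable (b : WittBasis V n) (p : Model n (Module.finrank ℝ V - 2 * n))

lemma form_fe (i j : Fin n) : dualForm V (b.f i) (b.e j) = if i = j then 1 else 0 := by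
  rw [dualForm_comm]; exact (b.form_ef j i).trans (by simp [eq_comm])

lemma form_ue (k) (i : Fin n) : dualForm V (b.u k) (b.e i) = 0 := by
  rw [dualForm_comm]; exact b.form_eu i k

lemma form_uf (k) (i : Fin n) : dualForm V (b.u k) (b.f i) = 0 := by
  rw [dualForm_comm]; exact b.form_fu i k

/-- General vectors of the form of a frame vector. -/
lemma form_general (x x' y y' : Fin n → ℂ) (z z' : Fin (Module.finrank ℝ V - 2 * n) → ℂ) :
    dualForm V (∑ i, x i • b.e i + ∑ j, y j • b.f j + ∑ k, z k • b.u k)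
      (∑ i, x' i • b.e i + ∑ j, y' j • b.f j + ∑ k, z' k • b.u k) =
    ∑ i, x i * y' i + ∑ i, y i * x' i
      + ∑ k, ∑ l, z k * dualForm V (b.u k) (b.u l) * z' l := by
  have h1 : ∀ i j, dualForm V (b.e i) (b.e j) = 0 := b.form_ee
  have h2 : ∀ i j, dualForm V (b.f i) (b.f j) = 0 := b.form_ff
  have h3 : ∀ i j, dualForm V (b.e i) (b.f j) = if i = j then 1 else 0 := b.form_ef
  have h4 : ∀ i k, dualForm V (b.e i) (b.u k) = 0 := b.form_eu
  have h5 : ∀ i k, dualForm V (b.f i) (b.u k) = 0 := b.form_fu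
  have h6 := b.form_fe
  have h7 := b.form_ue
  have h8 := b.form_uf
  have e1 : ∀ i, dualForm V (b.e i)
      (∑ i, x' i • b.e i + ∑ j, y' j • b.f j + ∑ k, z' k • b.u k) = y' i := by
    intro i; simp [map_add, map_sum, h1, h3, h4]
  have e2 : ∀ i, dualForm V (b.f i)
      (∑ i, x' i • b.e i + ∑ j, y' j • b.f j + ∑ k, z' k • b.u k) = x' i := by
    intro i; simp [map_add, map_sum, h2, h5, h6]
  have e3 : ∀ k, dualForm V (b.u k)
      (∑ i, x' i • b.e i + ∑ j, y' j • b.f j + ∑ k, z' k • b.u k) =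
      ∑ l, dualForm V (b.u k) (b.u l) * z' l := by
    intro k; simp [map_add, map_sum, h7, h8, mul_comm]
  simp only [map_add (dualForm V), map_sum (dualForm V), map_smul (dualForm V),
    LinearMap.add_apply, LinearMap.sum_apply, LinearMap.smul_apply, e1, e2, e3, smul_eq_mul,
    Finset.mul_sum, mul_assoc]

lemma expand (α : CDual V) : α = ∑ i, b.basis.repr α (.inl i) • b.e i
    + ∑ j, b.basis.repr α (.inr (.inl j)) • b.f j
    + ∑ k, b.basis.repr α (.inr (.inr k)) • b.u k := by
  have h := b.basis.sum_repr α
  rw [Fintype.sum_sum_type, Fintype.sum_sum_type, ← add_assoc] at h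
  exact h.symm

lemma repr_combo (x y : Fin n → ℂ) (z : Fin (Module.finrank ℝ V - 2 * n) → ℂ) :
    (b.basis.repr (∑ i, x i • b.e i + ∑ j, y j • b.f j + ∑ k, z k • b.u k) : _ → ℂ) =
      Sum.elim x (Sum.elim y z) := by
  have : ∑ i, x i • b.e i + ∑ j, y j • b.f j + ∑ k, z k • b.u k =
      ∑ s, (Sum.elim x (Sum.elim y z)) s • b.basis s := by
    simp [Fintype.sum_sum_type, e, f, u, add_assoc]
  rw [this, Module.Basis.repr_sum_self]

lemma frame_eq (i : Fin n) : b.frame p i = ∑ j, (Pi.single i (1 : ℂ) : Fin n → ℂ) j • b.e j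
    + ∑ j, b.quad p i j • b.f j + ∑ k, p.2 i k • b.u k := by
  simp [frame, Pi.single_apply]

lemma repr_frame (i : Fin n) : (b.basis.repr (b.frame p i) : _ → ℂ) =
    Sum.elim (Pi.single i 1) (Sum.elim (b.quad p i) (p.2 i)) := by
  rw [frame_eq, repr_combo]

lemma repr_frame_inl (i j : Fin n) :
    b.basis.repr (b.frame p i) (.inl j) = if j = i then 1 else 0 := by
  rw [repr_frame]; simp [Pi.single_apply]

lemma quad_add (i j : Fin n) : b.quad p i j + b.quad p j i
    + ∑ k, ∑ l, p.2 i k * dualForm V (b.u k) (b.u l) * p.2 j l = 0 := by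
  have h : ∑ k, ∑ l, p.2 j k * dualForm V (b.u k) (b.u l) * p.2 i l =
      ∑ k, ∑ l, p.2 i k * dualForm V (b.u k) (b.u l) * p.2 j l := by
    rw [Finset.sum_comm]
    refine Finset.sum_congr rfl fun k _ => Finset.sum_congr rfl fun l _ => ?_
    rw [dualForm_comm (b.u l)]; ring
  rw [quad, quad, h, p.1.2 i j]
  ring

lemma form_frame (i j : Fin n) : dualForm V (b.frame p i) (b.frame p j) = 0 := by
  rw [frame_eq, frame_eq, form_general, ← b.quad_add p i j]
  simp [Pi.single_apply]
  ring

lemma linearIndependent_frame : LinearIndependent ℂ (b.frame p) := by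
  rw [Fintype.linearIndependent_iff]
  intro g hg i
  have := congrArg (fun α => b.basis.repr α (.inl i)) hg
  simpa [repr_frame_inl] using this

/-- The isotropic subspace spanned by a frame. -/
def param : OG V n :=
  ⟨Submodule.span ℂ (Set.range (b.frame p)), by
    rw [finrank_span_eq_card (b.linearIndependent_frame p), Fintype.card_fin], by
    intro α hα β hβ
    induction hα using Submodule.span_induction with
    | zero => simp
    | add x y _ _ hx hy => simp [hx, hy]
    | smul c x _ hx => simp [hx]
    | mem x hx =>
      obtain ⟨i, rfl⟩ := hx
      induction hβ using Submodule.span_induction with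
      | zero => simp
      | add x y _ _ hx hy => simp [hx, hy]
      | smul c x _ hx => simp [hx]
      | mem x hx =>
        obtain ⟨j, rfl⟩ := hx
        exact b.form_frame p i j⟩

/-- A vector of the span of a frame is determined by its `e`-coordinates. -/
lemma eq_sum_of_mem {α : CDual V} (h : α ∈ (b.param p).1) :
    α = ∑ j, b.basis.repr α (.inl j) • b.frame p j := by
  obtain ⟨c, rfl⟩ := (Submodule.mem_span_range_iff_exists_fun ℂ).1 h
  refine Finset.sum_congr rfl fun i _ => ?_
  congr 1
  simp [repr_frame_inl]

lemma frame_mem (i : Fin n) : b.frame p i ∈ (b.param p).1 :=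
  Submodule.subset_span ⟨i, rfl⟩

lemma param_injective : Function.Injective b.param := by
  intro p p' h
  have key : ∀ i, b.frame p i = b.frame p' i := by
    intro i
    have h1 : b.frame p i ∈ (b.param p').1 := h ▸ b.frame_mem p i
    rw [b.eq_sum_of_mem p' h1]
    simp [repr_frame_inl]
  have h2 : p.2 = p'.2 := by
    ext i k
    have := congrArg (fun α => b.basis.repr α (.inr (.inr k))) (key i)
    simpa [repr_frame] using this
  refine Prod.ext (Subtype.ext ?_) h2
  ext i j
  have := congrArg (fun α => b.basis.repr α (.inr (.inl j))) (key i)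
  simpa [repr_frame, quad, h2] using this

/-- The chart of the orthogonal Grassmannian attached to a Witt basis. It is the restriction of the
standard graph chart of the Grassmannian to the isotropic subspaces: its domain consists of the
isotropic graphs of linear maps from the span of the `e_i` to the span of the `f_j` and the `u_k`,
and its inverse sends `(s, B)` to the span of the frame defined by `(s, B)`. -/
def chart : PartialEquiv (OG V n) (Model n (Module.finrank ℝ V - 2 * n)) where
  toFun := Function.invFun b.param
  invFun := b.param
  source := Set.range b.param
  target := Set.univ
  map_source' _ _ := Set.mem_univ _
  map_target' p _ := Set.mem_range_self p
  left_inv' _ hW := Function.invFun_eq hW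
  right_inv' p _ := Function.leftInverse_invFun b.param_injective p

end WittBasis

/-- Every isotropic subspace of dimension `n` is spanned by the first `n` vectors of a Witt
basis. -/
lemma exists_wittBasis (W : OG V n) :
    ∃ b : WittBasis V n, Submodule.span ℂ (Set.range b.e) = W.1 := by
  classical
  obtain ⟨W, hW, hiso⟩ := W
  set e : Fin n → CDual V := fun i => (Module.finBasisOfFinrankEq ℂ W hW i : CDual V) with he
  have heW : ∀ i, e i ∈ W := fun i => (Module.finBasisOfFinrankEq ℂ W hW i).2
  have heli : LinearIndependent ℂ e :=
    (Module.finBasisOfFinrankEq ℂ W hW).linearIndependent.map' W.subtype (by simp)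
  have hspan : Submodule.span ℂ (Set.range e) = W := by
    have := congrArg (Submodule.map W.subtype) (Module.finBasisOfFinrankEq ℂ W hW).span_eq
    rw [Submodule.map_span, ← Set.range_comp, Submodule.map_top, Submodule.range_subtype] at this
    exact this
  have hee : ∀ i j, dualForm V (e i) (e j) = 0 := fun i j => hiso _ (heW i) _ (heW j)
  have hflat : LinearIndependent ℂ (fun i => dualForm V (e i)) := by
    refine heli.map' (dualForm V) ?_
    rw [LinearMap.ker_eq_bot']
    intro α hα
    exact dualForm_nondegenerate α fun β => by rw [hα]; rfl
  have hsurj := pi_surjective (fun i => dualForm V (e i)) hflat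
  choose g hg using fun j => hsurj (Pi.single j 1)
  have heg : ∀ i j, dualForm V (e i) (g j) = if i = j then 1 else 0 := by
    intro i j
    have := congrFun (hg j) i
    simpa [Pi.single_apply] using this
  set f : Fin n → CDual V := fun j => g j - (2⁻¹ : ℂ) • ∑ l, dualForm V (g j) (g l) • e l with hf
  have hef : ∀ i j, dualForm V (e i) (f j) = if i = j then 1 else 0 := by
    intro i j
    simp only [hf, map_sub, map_smul, map_sum, heg, hee]
    simp
  have hgf : ∀ i j, dualForm V (g i) (f j) = 2⁻¹ * dualForm V (g i) (g j) := by
    intro i j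
    have hge : ∀ i j, dualForm V (g i) (e j) = if j = i then 1 else 0 := fun i j => by
      rw [dualForm_comm, heg]
    simp only [hf, map_sub, map_smul, map_sum, hge, smul_eq_mul, mul_ite, mul_one, mul_zero,
      Finset.sum_ite_eq', Finset.mem_univ, if_true]
    rw [dualForm_comm (g j)]
    ring
  have hff : ∀ i j, dualForm V (f i) (f j) = 0 := by
    intro i j
    have : f i = g i - (2⁻¹ : ℂ) • ∑ l, dualForm V (g i) (g l) • e l := rfl
    rw [this, LinearMap.map_sub₂, hgf, LinearMap.map_smul₂, LinearMap.map_sum₂]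
    simp only [LinearMap.map_smul₂, hef, smul_eq_mul, mul_ite,
      mul_one, mul_zero, Finset.sum_ite_eq', Finset.mem_univ, if_true]
    ring
  have hfe : ∀ i j, dualForm V (f i) (e j) = if i = j then 1 else 0 := fun i j => by
    rw [dualForm_comm, hef]; simp [eq_comm]
  let S : CDual V →ₗ[ℂ] (Fin n → ℂ) × (Fin n → ℂ) :=
    (LinearMap.pi fun i => dualForm V (e i)).prod (LinearMap.pi fun i => dualForm V (f i))
  have hS : Function.Surjective S := by
    rintro ⟨x, y⟩
    refine ⟨∑ i, x i • f i + ∑ i, y i • e i, Prod.ext ?_ ?_⟩ <;> ext i <;>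
      simp [S, hee, hff, hef, hfe]
  have hrk := LinearMap.finrank_range_add_finrank_ker S
  rw [LinearMap.range_eq_top.2 hS, finrank_top, finrank_cdual] at hrk
  simp only [Module.finrank_prod, Module.finrank_fin_fun] at hrk
  have hk : Module.finrank ℂ (LinearMap.ker S) = Module.finrank ℝ V - 2 * n := by omega
  set u : Fin (Module.finrank ℝ V - 2 * n) → CDual V :=
    fun k => (Module.finBasisOfFinrankEq ℂ (LinearMap.ker S) hk k : CDual V) with hu
  have hul : LinearIndependent ℂ u :=
    (Module.finBasisOfFinrankEq ℂ (LinearMap.ker S) hk).linearIndependent.map'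
      (LinearMap.ker S).subtype (by simp)
  have hSu : ∀ k, S (u k) = 0 := fun k =>
    (Module.finBasisOfFinrankEq ℂ (LinearMap.ker S) hk k).2
  have heu : ∀ i k, dualForm V (e i) (u k) = 0 := fun i k =>
    congrFun (congrArg Prod.fst (hSu k)) i
  have hfu : ∀ i k, dualForm V (f i) (u k) = 0 := fun i k =>
    congrFun (congrArg Prod.snd (hSu k)) i
  have hli : LinearIndependent ℂ (Sum.elim e (Sum.elim f u)) := by
    rw [Fintype.linearIndependent_iff]
    intro c hc
    rw [Fintype.sum_sum_type, Fintype.sum_sum_type] at hc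
    simp only [Sum.elim_inl, Sum.elim_inr] at hc
    have h1 : ∀ i, c (.inr (.inl i)) = 0 := by
      intro i
      have := congrArg (dualForm V (e i)) hc
      simpa [hee, hef, heu] using this
    have h2 : ∀ i, c (.inl i) = 0 := by
      intro i
      have := congrArg (dualForm V (f i)) hc
      simpa [hff, hfe, hfu] using this
    have h3 := Fintype.linearIndependent_iff.1 hul (fun k => c (.inr (.inr k)))
      (by simpa [h1, h2] using hc)
    rintro (i | i | k)
    exacts [h2 i, h1 i, h3 k]
  have hcard : Fintype.card (Fin n ⊕ Fin n ⊕ Fin (Module.finrank ℝ V - 2 * n)) =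
      Module.finrank ℂ (CDual V) := by
    rw [finrank_cdual]; simp; omega
  let B : Module.Basis (Fin n ⊕ Fin n ⊕ Fin (Module.finrank ℝ V - 2 * n)) ℂ (CDual V) :=
    Module.Basis.mk hli (hli.span_eq_top_of_card_eq_finrank' hcard).ge
  have hB : ∀ s, B s = Sum.elim e (Sum.elim f u) s := fun s => Module.Basis.mk_apply _ _ _
  refine ⟨⟨B, ?_, ?_, ?_, ?_, ?_⟩, ?_⟩
  · intro i j; simpa [hB] using hee i j
  · intro i j; simpa [hB] using hff i j
  · intro i j; simpa [hB] using hef i j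
  · intro i j; simpa [hB] using heu i j
  · intro i j; simpa [hB] using hfu i j
  · have : (WittBasis.e ⟨B, by intro i j; simpa [hB] using hee i j,
        by intro i j; simpa [hB] using hff i j, by intro i j; simpa [hB] using hef i j,
        by intro i j; simpa [hB] using heu i j, by intro i j; simpa [hB] using hfu i j⟩) = e := by
      ext1 i; simp [WittBasis.e, hB]
    rw [this, hspan]

namespace WittBasis

variable {V : Type u} [NormedAddCommGroup V] [InnerProductSpace ℝ V] [FiniteDimensional ℝ V]
  {n : ℕ}

variable (b b' : WittBasis V n) (p : Model n (Module.finrank ℝ V - 2 * n))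

/-- The skew-symmetric part of a matrix. -/
def skewPart (n : ℕ) : (Fin n → Fin n → ℂ) →ₗ[ℂ] skew n where
  toFun a := ⟨fun i j => 2⁻¹ * (a i j - a j i), fun i j => by ring⟩
  map_add' a a' := by ext i j; simp; ring
  map_smul' c a := by ext i j; simp; ring

/-- The `e`-coordinates of a family of `n` vectors. -/
def mat (A : Fin n → CDual V) : Matrix (Fin n) (Fin n) ℂ :=
  Matrix.of fun i j => b.basis.repr (A i) (.inl j)

/-- The coordinates, in the chart of a Witt basis, of the span of a family of `n` vectors. -/
def coordOf (A : Fin n → CDual V) : Model n (Module.finrank ℝ V - 2 * n) :=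
  (skewPart n fun i j => ∑ l, (b.mat A)⁻¹ i l * b.basis.repr (A l) (.inr (.inl j)),
    fun i k => ∑ l, (b.mat A)⁻¹ i l * b.basis.repr (A l) (.inr (.inr k)))

/-- The change of charts. -/
def transition : Model n (Module.finrank ℝ V - 2 * n) := b'.coordOf (b.frame p)

lemma det_ne_zero_of_mem {A : Fin n → CDual V} (hli : LinearIndependent ℂ A) {W : OG V n}
    (hA : ∀ i, A i ∈ W.1) (h : W ∈ Set.range b.param) : (b.mat A).det ≠ 0 := by
  obtain ⟨q, rfl⟩ := h
  intro h0
  obtain ⟨x, hx0, hx⟩ := Matrix.exists_vecMul_eq_zero_iff.2 h0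
  apply hx0
  have hmem : ∑ i, x i • A i ∈ (b.param q).1 :=
    Submodule.sum_mem _ fun i _ => Submodule.smul_mem _ _ (hA i)
  have h1 := b.eq_sum_of_mem q hmem
  have h2 : ∀ j, b.basis.repr (∑ i, x i • A i) (.inl j) = 0 := by
    intro j
    have := congrFun hx j
    simpa [Matrix.vecMul, dotProduct, mat] using this
  simp only [h2, zero_smul, Finset.sum_const_zero] at h1
  ext i
  exact Fintype.linearIndependent_iff.1 hli x h1 i

lemma param_coordOf {A : Fin n → CDual V} {W : OG V n} (hAW : ∀ i, A i ∈ W.1)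
    (h : (b.mat A).det ≠ 0) : b.param (b.coordOf A) = W := by
  have hP : (b.mat A)⁻¹ * b.mat A = 1 := Matrix.nonsing_inv_mul _ h.isUnit
  set A' : Fin n → CDual V := fun i => ∑ l, (b.mat A)⁻¹ i l • A l with hA
  have hAmem : ∀ i, A' i ∈ W.1 := fun i =>
    Submodule.sum_mem _ fun l _ => Submodule.smul_mem _ _ (hAW l)
  set a : Fin n → Fin n → ℂ :=
    fun i j => ∑ l, (b.mat A)⁻¹ i l * b.basis.repr (A l) (.inr (.inl j)) with ha
  have hA1 : ∀ i j, b.basis.repr (A' i) (.inl j) = (Pi.single i (1 : ℂ) : Fin n → ℂ) j := by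
    intro i j
    have := congrFun (congrFun hP i) j
    rw [Matrix.mul_apply] at this
    simp only [mat, Matrix.of_apply] at this
    simpa [hA, Matrix.one_apply, Pi.single_apply, eq_comm, mat] using this
  have hA2 : ∀ i j, b.basis.repr (A' i) (.inr (.inl j)) = a i j := by
    intro i j; simp [hA, ha]
  have hA3 : ∀ i k, b.basis.repr (A' i) (.inr (.inr k)) = (b.coordOf A).2 i k := by
    intro i j; simp [hA, coordOf]
  have hexp : ∀ i, A' i = ∑ j, (Pi.single i (1 : ℂ) : Fin n → ℂ) j • b.e j
      + ∑ j, a i j • b.f j + ∑ k, (b.coordOf A).2 i k • b.u k := by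
    intro i
    have := b.expand (A' i)
    simp only [hA1, hA2, hA3] at this
    exact this
  have hiso : ∀ i j, a j i + a i j + ∑ k, ∑ l, (b.coordOf A).2 i k *
      dualForm V (b.u k) (b.u l) * (b.coordOf A).2 j l = 0 := by
    intro i j
    have := W.2.2 _ (hAmem i) _ (hAmem j)
    rw [hexp i, hexp j, form_general] at this
    simpa [Pi.single_apply] using this
  have hquad : ∀ i j, b.quad (b.coordOf A) i j = a i j := by
    intro i j
    have h1 : ((b.coordOf A).1 : Fin n → Fin n → ℂ) i j = 2⁻¹ * (a i j - a j i) := rfl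
    rw [quad, h1]
    linear_combination (-2⁻¹ : ℂ) * hiso i j
  have hframe : ∀ i, b.frame (b.coordOf A) i = A' i := by
    intro i
    rw [hexp i, frame_eq]
    simp only [hquad]
  refine Subtype.ext (Submodule.eq_of_le_of_finrank_eq ?_ ?_)
  · refine Submodule.span_le.2 ?_
    rintro _ ⟨i, rfl⟩
    rw [hframe]
    exact hAmem i
  · rw [(b.param _).2.1, W.2.1]

lemma mem_range_iff : b.param p ∈ Set.range b'.param ↔ (b'.mat (b.frame p)).det ≠ 0 :=
  ⟨b'.det_ne_zero_of_mem (b.linearIndependent_frame p) (b.frame_mem p),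
    fun h => ⟨_, b'.param_coordOf (b.frame_mem p) h⟩⟩

@[simp] lemma chart_param : b.chart (b.param p) = p :=
  Function.leftInverse_invFun b.param_injective p

lemma param_chart {W : OG V n} (hW : W ∈ b.chart.source) : b.param (b.chart W) = W :=
  b.chart.left_inv hW

lemma symm_trans_source :
    (b.chart.symm.trans b'.chart).source = {p | (b'.mat (b.frame p)).det ≠ 0} := by
  ext p
  rw [PartialEquiv.trans_source]
  change _ ∧ b.param p ∈ Set.range b'.param ↔ _
  rw [mem_range_iff]
  exact ⟨fun h => h.2, fun h => ⟨Set.mem_univ _, h⟩⟩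

lemma symm_trans_eqOn :
    Set.EqOn (b.chart.symm.trans b'.chart) (b.transition b') {p | (b'.mat (b.frame p)).det ≠ 0} := by
  intro p hp
  change b'.chart (b.param p) = _
  rw [← b'.param_coordOf (b.frame_mem p) hp, chart_param]; rfl

lemma contDiff_fst_apply {k : ℕ} (i j : Fin n) : ContDiff ℂ ω
    (fun p : Model n k => (p.1 : Fin n → Fin n → ℂ) i j) := by
  have h : ContDiff ℂ ω (fun p : Model n k => (p.1 : Fin n → Fin n → ℂ)) :=
    (skew n).subtypeL.contDiff.comp contDiff_fst
  exact contDiff_pi.1 (contDiff_pi.1 h i) j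

lemma contDiff_snd_apply {k : ℕ} (i : Fin n) (l : Fin k) :
    ContDiff ℂ ω (fun p : Model n k => p.2 i l) :=
  contDiff_pi.1 (contDiff_pi.1 contDiff_snd i) l

lemma contDiff_quad (i j : Fin n) : ContDiff ℂ ω fun p => b.quad p i j := by
  refine (contDiff_fst_apply i j).sub (contDiff_const.mul ?_)
  refine ContDiff.sum fun k _ => ContDiff.sum fun l _ => ?_
  exact ((contDiff_snd_apply i k).mul contDiff_const).mul (contDiff_snd_apply j l)

/-- Linear functionals of the frame vectors are polynomial in the coordinates. -/
lemma contDiff_frame (φ : CDual V →ₗ[ℂ] ℂ) (i : Fin n) :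
    ContDiff ℂ ω fun p => φ (b.frame p i) := by
  simp only [frame, map_add, map_sum, map_smul, smul_eq_mul]
  refine (contDiff_const.add (ContDiff.sum fun j _ => ?_)).add (ContDiff.sum fun k _ => ?_)
  · exact (b.contDiff_quad i j).mul contDiff_const
  · exact (contDiff_snd_apply i k).mul contDiff_const

lemma contDiff_repr (i : Fin n) (s) :
    ContDiff ℂ ω fun p => b'.basis.repr (b.frame p i) s :=
  b.contDiff_frame (b'.basis.coord s) i

lemma contDiff_det {X : Type*} [NormedAddCommGroup X] [NormedSpace ℂ X]
    {M : X → Matrix (Fin n) (Fin n) ℂ} (h : ∀ i j, ContDiff ℂ ω fun p => M p i j) :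
    ContDiff ℂ ω fun p => (M p).det := by
  simp only [Matrix.det_apply]
  refine ContDiff.sum fun σ _ => ContDiff.const_smul _ ?_
  exact contDiff_prod fun i _ => h _ _

lemma contDiffOn_inv {X : Type*} [NormedAddCommGroup X] [NormedSpace ℂ X]
    {M : X → Matrix (Fin n) (Fin n) ℂ} (h : ∀ i j, ContDiff ℂ ω fun p => M p i j) (i j : Fin n) :
    ContDiffOn ℂ ω (fun p => (M p)⁻¹ i j) {p | (M p).det ≠ 0} := by
  simp only [Matrix.inv_def, Matrix.smul_apply, Ring.inverse_eq_inv', smul_eq_mul,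
    Matrix.adjugate_apply]
  refine ContDiffOn.mul ((contDiff_det h).contDiffOn.inv fun p hp => hp) (ContDiff.contDiffOn ?_)
  refine contDiff_det fun k l => ?_
  by_cases hk : k = j
  · subst hk; simp only [Matrix.updateRow_self]; exact contDiff_const
  · simp only [Matrix.updateRow_ne hk]; exact h k l

lemma contDiffOn_transition :
    ContDiffOn ℂ ω (b.transition b') {p | (b'.mat (b.frame p)).det ≠ 0} := by
  have hinv := contDiffOn_inv (M := fun p => b'.mat (b.frame p)) (fun i j => b.contDiff_repr b' i (.inl j))
  refine ContDiffOn.prodMk ?_ ?_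
  · refine (LinearMap.toContinuousLinearMap (skewPart n)).contDiff.comp_contDiffOn ?_
    refine contDiffOn_pi.2 fun i => contDiffOn_pi.2 fun j => ContDiffOn.sum fun l _ => ?_
    exact (hinv i l).mul (b.contDiff_repr b' l _).contDiffOn
  · refine contDiffOn_pi.2 fun i => contDiffOn_pi.2 fun j => ContDiffOn.sum fun l _ => ?_
    exact (hinv i l).mul (b.contDiff_repr b' l _).contDiffOn

lemma isOpen_det_ne_zero : IsOpen {p | (b'.mat (b.frame p)).det ≠ 0} :=
  (contDiff_det (M := fun p => b'.mat (b.frame p)) fun i j => b.contDiff_repr b' i (.inl j)).continuous.isOpen_preimage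
    {0}ᶜ isOpen_compl_singleton

lemma contDiffOn_symm_trans : ContDiffOn ℂ ω (b.chart.symm.trans b'.chart)
    (b.chart.symm.trans b'.chart).source := by
  rw [symm_trans_source]
  exact (b.contDiffOn_transition b').congr (b.symm_trans_eqOn b')

end WittBasis

section Charts

variable (V : Type u) [NormedAddCommGroup V] [InnerProductSpace ℝ V] [FiniteDimensional ℝ V]
  (n : ℕ)

/-- A Witt basis whose first `n` vectors span the given isotropic subspace. -/
def wittBasisAt {V : Type u} [NormedAddCommGroup V] [InnerProductSpace ℝ V]
    [FiniteDimensional ℝ V] {n : ℕ} (W : OG V n) : WittBasis V n :=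
  Classical.choose (exists_wittBasis W)

variable {V n} in
lemma mem_chart_wittBasisAt (W : OG V n) : W ∈ (wittBasisAt W).chart.source := by
  refine ⟨0, Subtype.ext ?_⟩
  rw [← Classical.choose_spec (exists_wittBasis W)]
  change Submodule.span ℂ (Set.range _) = Submodule.span ℂ (Set.range _)
  congr 2
  ext1 i
  simp [WittBasis.frame, WittBasis.quad, wittBasisAt]

/-- The atlas of the orthogonal Grassmannian, consisting of the charts of all Witt bases. -/
def chartedSpaceCore : ChartedSpaceCore (Model n (Module.finrank ℝ V - 2 * n)) (OG V n) where
  atlas := Set.range WittBasis.chart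
  chartAt W := (wittBasisAt W).chart
  mem_chart_source := mem_chart_wittBasisAt
  chart_mem_atlas W := ⟨_, rfl⟩
  open_source := by
    rintro _ _ ⟨b, rfl⟩ ⟨b', rfl⟩
    rw [b.symm_trans_source b']
    exact b.isOpen_det_ne_zero b'
  continuousOn_toFun := by
    rintro _ _ ⟨b, rfl⟩ ⟨b', rfl⟩
    exact (b.contDiffOn_symm_trans b').continuousOn

/-- The manifold topology of the orthogonal Grassmannian. -/
instance : TopologicalSpace (OG V n) := (chartedSpaceCore V n).toTopologicalSpace

instance : ChartedSpace (Model n (Module.finrank ℝ V - 2 * n)) (OG V n) :=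
  (chartedSpaceCore V n).toChartedSpace

variable {V n} in
/-- The chart of a Witt basis as a homeomorphism between open sets. -/
def WittBasis.chartHomeo (b : WittBasis V n) :
    OpenPartialHomeomorph (OG V n) (Model n (Module.finrank ℝ V - 2 * n)) :=
  (chartedSpaceCore V n).openPartialHomeomorph b.chart ⟨b, rfl⟩

variable {V n} in
lemma WittBasis.chartHomeo_mem_atlas (b : WittBasis V n) :
    b.chartHomeo ∈ atlas (Model n (Module.finrank ℝ V - 2 * n)) (OG V n) :=
  Set.mem_iUnion₂.2 ⟨b.chart, ⟨b, rfl⟩, rfl⟩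

/-- The orthogonal Grassmannian is a complex manifold. -/
instance : IsManifold 𝓘(ℂ, Model n (Module.finrank ℝ V - 2 * n)) ω (OG V n) := by
  refine isManifold_of_contDiffOn _ _ _ fun e e' he he' => ?_
  obtain ⟨_, ⟨b, rfl⟩, rfl⟩ := Set.mem_iUnion₂.1 he
  obtain ⟨_, ⟨b', rfl⟩, rfl⟩ := Set.mem_iUnion₂.1 he'
  simp only [modelWithCornersSelf_coe, modelWithCornersSelf_coe_symm, Function.comp_id,
    Function.id_comp, Set.preimage_id, Set.range_id, Set.inter_univ]
  exact b.contDiffOn_symm_trans b'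

variable {V n} in
lemma WittBasis.continuous_param (b : WittBasis V n) : Continuous b.param :=
  continuousOn_univ.1 b.chartHomeo.symm.continuousOn

variable {V n} in
lemma WittBasis.isOpenMap_param (b : WittBasis V n) : IsOpenMap b.param := by
  intro s hs
  have h : b.param '' s = b.chartHomeo.symm '' s := rfl
  rw [h]
  exact b.chartHomeo.symm.isOpen_image_of_subset_source hs fun _ _ => Set.mem_univ _

variable {V n} in
/-- The pairs of coordinates that describe the same point form a closed set. -/
lemma WittBasis.isClosed_param_eq (b b' : WittBasis V n) :
    IsClosed {x : Model n (Module.finrank ℝ V - 2 * n) × Model n (Module.finrank ℝ V - 2 * n) |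
      b.param x.1 = b'.param x.2} := by
  have h : {x : Model n (Module.finrank ℝ V - 2 * n) × Model n (Module.finrank ℝ V - 2 * n) |
      b.param x.1 = b'.param x.2} = ⋂ i : Fin n, ⋂ s, {x | b.basis.repr (b.frame x.1 i) s =
        ∑ j, b'.basis.repr (b.frame x.1 i) (.inl j) * b.basis.repr (b'.frame x.2 j) s} := by
    ext ⟨p, q⟩
    simp only [Set.mem_ofPred_eq, Set.mem_iInter]
    constructor
    · intro h i s
      have := b'.eq_sum_of_mem q (h ▸ b.frame_mem p i)
      conv_lhs => rw [this]
      simp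
    · intro h
      have key : ∀ i, b.frame p i =
          ∑ j, b'.basis.repr (b.frame p i) (.inl j) • b'.frame q j := by
        intro i
        refine b.basis.repr.injective (Finsupp.ext fun s => ?_)
        rw [h i s]
        simp
      refine Subtype.ext (Submodule.eq_of_le_of_finrank_eq (Submodule.span_le.2 ?_) ?_)
      · rintro _ ⟨i, rfl⟩
        rw [key i]
        exact Submodule.sum_mem _ fun j _ => Submodule.smul_mem _ _ (b'.frame_mem q j)
      · rw [(b.param _).2.1, (b'.param _).2.1]
  rw [h]
  refine isClosed_iInter fun i => isClosed_iInter fun s => isClosed_eq ?_ ?_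
  · exact (b.contDiff_repr b i s).continuous.comp continuous_fst
  · exact continuous_finsetSum _ fun j _ =>
      ((b.contDiff_repr b' i _).continuous.comp continuous_fst).mul
        ((b'.contDiff_repr b j s).continuous.comp continuous_snd)

instance : T2Space (OG V n) where
  t2 := by
    intro W W' hne
    obtain ⟨p, hp⟩ := mem_chart_wittBasisAt W
    obtain ⟨q, hq⟩ := mem_chart_wittBasisAt W'
    have hopen := ((wittBasisAt W).isClosed_param_eq (wittBasisAt W')).isOpen_compl
    obtain ⟨S, T, hS, hT, hpS, hqT, hST⟩ := isOpen_prod_iff.1 hopen p q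
      (by simp only [Set.mem_compl_iff, Set.mem_ofPred_eq, hp, hq]; exact hne)
    refine ⟨_, _, (wittBasisAt W).isOpenMap_param S hS, (wittBasisAt W').isOpenMap_param T hT,
      ⟨p, hpS, hp⟩, ⟨q, hqT, hq⟩, ?_⟩
    rw [Set.disjoint_left]
    rintro _ ⟨p', hp', rfl⟩ ⟨q', hq', h⟩
    exact hST (Set.mk_mem_prod hp' hq') h.symm

/-- The families of `n` vectors of `V_ℂ^*`, in coordinates, that span an isotropic subspace of
dimension `n`. -/
def Frames : Type :=
  {x : Fin n → Fin (Module.finrank ℂ (CDual V)) → ℂ //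
    ∃ W : OG V n, Submodule.span ℂ
      (Set.range fun i => ∑ k, x i k • Module.finBasis ℂ (CDual V) k) = W.1}

instance : TopologicalSpace (Frames V n) := inferInstanceAs (TopologicalSpace (Subtype _))

instance : SecondCountableTopology (Frames V n) :=
  inferInstanceAs (SecondCountableTopology (Subtype _))

variable {V n} in
/-- The span of a frame. -/
def Frames.span (x : Frames V n) : OG V n := Classical.choose x.2

variable {V n} in
/-- The vectors of a frame. -/
def Frames.vec (x : Frames V n) (i : Fin n) : CDual V :=
  ∑ k, x.1 i k • Module.finBasis ℂ (CDual V) k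

variable {V n} in
lemma Frames.span_eq (x : Frames V n) :
    Submodule.span ℂ (Set.range x.vec) = x.span.1 := Classical.choose_spec x.2

lemma Frames.continuous_vec (φ : CDual V →ₗ[ℂ] ℂ) (i : Fin n) :
    Continuous fun x : Frames V n => φ (x.vec i) := by
  simp only [Frames.vec, map_sum, map_smul, smul_eq_mul]
  refine continuous_finsetSum _ fun k _ => Continuous.mul ?_ continuous_const
  exact (continuous_apply k).comp ((continuous_apply i).comp continuous_subtype_val)

lemma Frames.continuous_span : Continuous (Frames.span : Frames V n → OG V n) := by
  rw [continuous_iff_continuousAt]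
  intro x₀
  set b := wittBasisAt x₀.span
  have hmem : ∀ (x : Frames V n) i, x.vec i ∈ x.span.1 := fun x i => by
    rw [← x.span_eq]; exact Submodule.subset_span ⟨i, rfl⟩
  have hli : LinearIndependent ℂ x₀.vec := by
    rw [linearIndependent_iff_card_eq_finrank_span, Set.finrank, x₀.span_eq, x₀.span.2.1,
      Fintype.card_fin]
  have hdet₀ : (b.mat x₀.vec).det ≠ 0 :=
    b.det_ne_zero_of_mem hli (hmem x₀) (mem_chart_wittBasisAt _)
  have hmat : Continuous fun x : Frames V n => b.mat x.vec :=
    continuous_matrix fun i j => Frames.continuous_vec V n (b.basis.coord _) i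
  have hopen : IsOpen {x : Frames V n | (b.mat x.vec).det ≠ 0} :=
    hmat.matrix_det.isOpen_preimage {0}ᶜ isOpen_compl_singleton
  have hinv : ∀ i l, ContinuousAt (fun x : Frames V n => (b.mat x.vec)⁻¹ i l) x₀ := by
    intro i l
    simp only [Matrix.inv_def, Matrix.smul_apply, Ring.inverse_eq_inv', smul_eq_mul]
    exact (hmat.matrix_det.continuousAt.inv₀ hdet₀).mul
      (hmat.matrix_adjugate.matrix_elem i l).continuousAt
  have hcoord : ContinuousAt (fun x : Frames V n => b.coordOf x.vec) x₀ := by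
    refine ContinuousAt.prodMk ?_ ?_
    · refine (LinearMap.toContinuousLinearMap
        (WittBasis.skewPart n)).continuous.continuousAt.comp ?_
      refine continuousAt_pi.2 fun i => continuousAt_pi.2 fun j => ?_
      exact tendsto_finsetSum _ fun l _ =>
        (hinv i l).mul (Frames.continuous_vec V n (b.basis.coord _) l).continuousAt
    · refine continuousAt_pi.2 fun i => continuousAt_pi.2 fun j => ?_
      exact tendsto_finsetSum _ fun l _ =>
        (hinv i l).mul (Frames.continuous_vec V n (b.basis.coord _) l).continuousAt
  refine (b.continuous_param.continuousAt.comp hcoord).congr ?_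
  filter_upwards [hopen.mem_nhds hdet₀] with x hx
  exact b.param_coordOf (hmem x) hx

lemma Frames.span_surjective : Function.Surjective (Frames.span : Frames V n → OG V n) := by
  intro W
  set B := Module.finBasis ℂ (CDual V)
  set e := (wittBasisAt W).e
  have he : Submodule.span ℂ (Set.range e) = W.1 := Classical.choose_spec (exists_wittBasis W)
  have hx : ∀ i, ∑ k, B.repr (e i) k • B k = e i := fun i => B.sum_repr _
  refine ⟨⟨fun i k => B.repr (e i) k, W, ?_⟩, ?_⟩
  · rw [← he]; congr 2; ext1 i; exact hx i
  · refine Subtype.ext ((Frames.span_eq _).symm.trans (Eq.trans ?_ he))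
    congr 2; ext1 i; exact hx i

instance : SecondCountableTopology (OG V n) := by
  have h := isLindelof_range (Frames.continuous_span V n)
  rw [(Frames.span_surjective V n).range_eq] at h
  obtain ⟨t, ht, htu⟩ := h.elim_nhds_subcover
    (fun W => (chartAt (Model n (Module.finrank ℝ V - 2 * n)) W).source)
    (fun W _ => (chartAt _ W).open_source.mem_nhds (mem_chart_source _ W))
  exact ChartedSpace.secondCountable_of_countable_cover (Model n (Module.finrank ℝ V - 2 * n))
    (s := t) (Set.eq_univ_of_univ_subset htu.2) ht

end Charts

end Grassmannian

/-! ### The universal quotient bundle -/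

section Universal

open Bundle

variable {V : Type u} [NormedAddCommGroup V] [InnerProductSpace ℝ V] [FiniteDimensional ℝ V]
  {n : ℕ}

/-- The fibre of the universal quotient bundle at the point `Λ^* ⊆ V_ℂ^*`: the quotient `Λ` of
`V_ℂ` by the common kernel of the functionals in `Λ^*`. -/
def UnivFiber (W : OG V n) : Type u := (ℂ ⊗[ℝ] V) ⧸ W.1.dualCoannihilator

instance (W : OG V n) : AddCommGroup (UnivFiber W) :=
  inferInstanceAs (AddCommGroup ((ℂ ⊗[ℝ] V) ⧸ W.1.dualCoannihilator))

instance (W : OG V n) : Module ℂ (UnivFiber W) :=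
  inferInstanceAs (Module ℂ ((ℂ ⊗[ℝ] V) ⧸ W.1.dualCoannihilator))

/-- The canonical topology of a finite-dimensional complex vector space. -/
instance (W : OG V n) : TopologicalSpace (UnivFiber W) := moduleTopology ℂ _

instance (W : OG V n) : IsModuleTopology ℂ (UnivFiber W) := ⟨rfl⟩

/-- The quotient map `V_ℂ → Λ`. -/
def univQuot (W : OG V n) : (ℂ ⊗[ℝ] V) →ₗ[ℂ] UnivFiber W := W.1.dualCoannihilator.mkQ

lemma univQuot_surjective (W : OG V n) : Function.Surjective (univQuot W) :=
  Submodule.mkQ_surjective _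

open scoped Classical in
/-- The frame of the tautological bundle over the domain of the chart of a Witt basis (and zero
elsewhere). -/
def WittBasis.localFrame (b : WittBasis V n) (W : OG V n) (i : Fin n) : CDual V :=
  if W ∈ b.chart.source then b.frame (b.chart W) i else 0

variable (b b' : WittBasis V n)

lemma WittBasis.localFrame_eq {W : OG V n} (h : W ∈ b.chart.source) :
    b.localFrame W = b.frame (b.chart W) := by
  ext1 i; simp only [localFrame, if_pos h]

lemma WittBasis.localFrame_mem (W : OG V n) (i : Fin n) : b.localFrame W i ∈ W.1 := by
  by_cases h : W ∈ b.chart.source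
  · have := b.frame_mem (b.chart W) i
    rw [b.param_chart h] at this
    rwa [b.localFrame_eq h]
  · simp only [localFrame, if_neg h]; exact W.1.zero_mem

lemma WittBasis.eq_sum_localFrame {W : OG V n} (h : W ∈ b.chart.source) {α : CDual V}
    (hα : α ∈ W.1) : α = ∑ j, b.basis.repr α (.inl j) • b.localFrame W j := by
  rw [b.localFrame_eq h]
  exact b.eq_sum_of_mem (b.chart W) (by rwa [b.param_chart h])

/-- The coordinates on the fibre `Λ` given by the frame `w_1, …, w_n` of `Λ^*`:
`λ ↦ (w_1(λ), …, w_n(λ))`. -/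
def WittBasis.coords (W : OG V n) : UnivFiber W →ₗ[ℂ] (Fin n → ℂ) :=
  Submodule.liftQ _ (LinearMap.pi (b.localFrame W)) (by
    intro v hv
    rw [LinearMap.mem_ker]
    ext i
    exact (Submodule.mem_dualCoannihilator _).1 hv _ (b.localFrame_mem W i))

lemma WittBasis.coords_univQuot (W : OG V n) (v : ℂ ⊗[ℝ] V) (i : Fin n) :
    b.coords W (univQuot W v) i = b.localFrame W i v := rfl

lemma WittBasis.coords_bijective {W : OG V n} (h : W ∈ b.chart.source) :
    Function.Bijective (b.coords W) := by
  constructor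
  · rw [injective_iff_map_eq_zero]
    intro y hy
    obtain ⟨v, rfl⟩ := univQuot_surjective W y
    refine (Submodule.Quotient.mk_eq_zero _).2 ((Submodule.mem_dualCoannihilator _).2 ?_)
    intro α hα
    rw [b.eq_sum_localFrame h hα]
    have : ∀ j, b.localFrame W j v = 0 := fun j => congrFun hy j
    simp [this]
  · intro y
    have hli : LinearIndependent ℂ (b.localFrame W) := by
      rw [b.localFrame_eq h]; exact b.linearIndependent_frame _
    obtain ⟨v, hv⟩ := pi_surjective _ hli y
    exact ⟨univQuot W v, hv⟩

/-- The coordinates on a fibre over the domain of a chart, as a linear isomorphism. -/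
def WittBasis.coordsEquiv {W : OG V n} (h : W ∈ b.chart.source) :
    UnivFiber W ≃ₗ[ℂ] (Fin n → ℂ) :=
  LinearEquiv.ofBijective (b.coords W) (b.coords_bijective h)

/-- The matrix of the change of coordinates on the fibres. -/
def WittBasis.changeMat (W : OG V n) (i j : Fin n) : ℂ :=
  b.basis.repr (b'.frame (b'.chart W) i) (.inl j)

/-- The elementary endomorphisms of `ℂ^n`. -/
def elem (n : ℕ) (i j : Fin n) : (Fin n → ℂ) →L[ℂ] (Fin n → ℂ) :=
  LinearMap.toContinuousLinearMap ((LinearMap.single ℂ (fun _ => ℂ) i) ∘ₗ (LinearMap.proj j))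

/-- The change of coordinates on the fibres. -/
def WittBasis.change (W : OG V n) : (Fin n → ℂ) →L[ℂ] (Fin n → ℂ) :=
  ∑ i, ∑ j, b.changeMat b' W i j • elem n i j

lemma WittBasis.change_apply (W : OG V n) (y : Fin n → ℂ) (i : Fin n) :
    b.change b' W y i = ∑ j, b.changeMat b' W i j * y j := by
  simp only [change, sum_apply, smul_apply,
    Finset.sum_apply, Pi.smul_apply, smul_eq_mul, elem, LinearMap.coe_toContinuousLinearMap',
    LinearMap.comp_apply, LinearMap.proj_apply, LinearMap.single_apply]
  rw [Finset.sum_eq_single i]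
  · simp
  · intro k _ hk
    simp [hk.symm]
  · simp

lemma WittBasis.change_coords {W : OG V n} (h : W ∈ b.chart.source) (h' : W ∈ b'.chart.source)
    (y : UnivFiber W) : b.change b' W (b.coords W y) = b'.coords W y := by
  ext i
  obtain ⟨v, rfl⟩ := univQuot_surjective W y
  rw [change_apply]
  simp only [coords_univQuot]
  have := b.eq_sum_localFrame h (b'.localFrame_mem W i)
  conv_rhs => rw [this]
  simp [changeMat, b'.localFrame_eq h']

lemma WittBasis.contMDiffOn_chart : ContMDiffOn
    𝓘(ℂ, Model n (Module.finrank ℝ V - 2 * n)) 𝓘(ℂ, Model n (Module.finrank ℝ V - 2 * n)) ω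
    b.chart b.chart.source :=
  contMDiffOn_of_mem_maximalAtlas (e := b.chartHomeo)
    (IsManifold.subset_maximalAtlas b.chartHomeo_mem_atlas)

lemma WittBasis.contMDiffOn_comp_chart {E : Type*} [NormedAddCommGroup E] [NormedSpace ℂ E]
    {g : Model n (Module.finrank ℝ V - 2 * n) → E} (hg : ContDiff ℂ ω g) :
    ContMDiffOn 𝓘(ℂ, Model n (Module.finrank ℝ V - 2 * n)) 𝓘(ℂ, E) ω
      (fun W => g (b.chart W)) b.chart.source :=
  hg.contMDiff.comp_contMDiffOn b.contMDiffOn_chart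

lemma WittBasis.contMDiffOn_change : ContMDiffOn
    𝓘(ℂ, Model n (Module.finrank ℝ V - 2 * n)) 𝓘(ℂ, (Fin n → ℂ) →L[ℂ] (Fin n → ℂ)) ω
    (b.change b') b'.chart.source := by
  refine b'.contMDiffOn_comp_chart
    (g := fun p => ∑ i, ∑ j, b.basis.repr (b'.frame p i) (.inl j) • elem n i j) ?_
  exact ContDiff.sum fun i _ => ContDiff.sum fun j _ => (b'.contDiff_repr b i _).smul contDiff_const

lemma WittBasis.isOpen_chart_source : IsOpen b.chart.source := b.chartHomeo.open_source

open scoped Classical in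
/-- The local trivialization of the universal quotient bundle over the domain of a chart. -/
def WittBasis.pretrivialization :
    Pretrivialization (Fin n → ℂ) (π (Fin n → ℂ) (UnivFiber (V := V) (n := n))) where
  toFun z := (z.1, b.coords z.1 z.2)
  invFun z := ⟨z.1, if h : z.1 ∈ b.chart.source then (b.coordsEquiv h).symm z.2 else 0⟩
  source := π _ _ ⁻¹' b.chart.source
  target := b.chart.source ×ˢ Set.univ
  baseSet := b.chart.source
  map_source' z hz := ⟨hz, Set.mem_univ _⟩
  map_target' z hz := hz.1
  left_inv' := by
    rintro ⟨W, y⟩ hW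
    have hW : W ∈ b.chart.source := hW
    simp only [hW, dif_pos]
    congr 1
    exact (b.coordsEquiv hW).symm_apply_apply y
  right_inv' := by
    rintro ⟨W, y⟩ ⟨hW, -⟩
    have hW : W ∈ b.chart.source := hW
    simp only [hW, dif_pos]
    congr 1
    exact (b.coordsEquiv hW).apply_symm_apply y
  open_target := b.isOpen_chart_source.prod isOpen_univ
  open_baseSet := b.isOpen_chart_source
  source_eq := rfl
  target_eq := rfl
  proj_toFun _ _ := rfl

variable (V n) in
/-- The universal quotient bundle as a family of compatible local trivializations. -/
def univPrebundle : VectorPrebundle ℂ (Fin n → ℂ) (UnivFiber (V := V) (n := n)) where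
  pretrivializationAtlas := Set.range WittBasis.pretrivialization
  pretrivialization_linear' := by
    rintro _ ⟨b, rfl⟩
    exact ⟨fun W _ => (b.coords W).isLinear⟩
  pretrivializationAt W := (wittBasisAt W).pretrivialization
  mem_base_pretrivializationAt := mem_chart_wittBasisAt
  pretrivialization_mem_atlas W := ⟨_, rfl⟩
  exists_coordChange := by
    rintro _ ⟨b, rfl⟩ _ ⟨b', rfl⟩
    refine ⟨b.change b', (b.contMDiffOn_change b').continuousOn.mono Set.inter_subset_right, ?_⟩
    rintro W ⟨hW, hW'⟩ y
    obtain ⟨z, rfl⟩ := (b.coords_bijective hW).2 y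
    rw [b.change_coords b' hW hW']
    have : b.pretrivialization.symm W (b.coords W z) = z :=
      b.pretrivialization.symm_apply_apply_mk hW z
    rw [this]
    rfl
  totalSpaceMk_isInducing W := by
    have h := mem_chart_wittBasisAt W
    let L := (wittBasisAt W).coordsEquiv h
    have h1 : Continuous L := IsModuleTopology.continuous_of_linearMap L.toLinearMap
    have := IsModuleTopology.topologicalAddGroup ℂ (UnivFiber W)
    have := IsModuleTopology.toContinuousSMul ℂ (UnivFiber W)
    have h2 : Continuous L.symm :=
      LinearMap.continuous_of_finiteDimensional L.symm.toLinearMap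
    have h3 : Topology.IsInducing L :=
      (Homeomorph.mk L.toEquiv h1 h2).isInducing
    have h4 : Topology.IsInducing (fun y : Fin n → ℂ => (W, y)) :=
      Topology.isInducing_const_prod.2 Topology.IsInducing.id
    exact h4.comp h3

instance : (univPrebundle V n).IsContMDiff 𝓘(ℂ, Model n (Module.finrank ℝ V - 2 * n)) ω where
  exists_contMDiffCoordChange := by
    rintro _ ⟨b, rfl⟩ _ ⟨b', rfl⟩
    refine ⟨b.change b', (b.contMDiffOn_change b').mono Set.inter_subset_right, ?_⟩
    rintro W ⟨hW, hW'⟩ y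
    obtain ⟨z, rfl⟩ := (b.coords_bijective hW).2 y
    rw [b.change_coords b' hW hW']
    have : b.pretrivialization.symm W (b.coords W z) = z :=
      b.pretrivialization.symm_apply_apply_mk hW z
    rw [this]
    rfl

instance : TopologicalSpace (TotalSpace (Fin n → ℂ) (UnivFiber (V := V) (n := n))) :=
  (univPrebundle V n).totalSpaceTopology

instance : FiberBundle (Fin n → ℂ) (UnivFiber (V := V) (n := n)) :=
  (univPrebundle V n).toFiberBundle

instance : VectorBundle ℂ (Fin n → ℂ) (UnivFiber (V := V) (n := n)) :=
  (univPrebundle V n).toVectorBundle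

instance : ContMDiffVectorBundle ω (Fin n → ℂ) (UnivFiber (V := V) (n := n))
    𝓘(ℂ, Model n (Module.finrank ℝ V - 2 * n)) :=
  (univPrebundle V n).contMDiffVectorBundle _

/-- For every `v` in `V_ℂ`, the class of `v` is a holomorphic section of the universal bundle. -/
lemma contMDiff_univQuot (v : ℂ ⊗[ℝ] V) :
    ContMDiff 𝓘(ℂ, Model n (Module.finrank ℝ V - 2 * n))
      (𝓘(ℂ, Model n (Module.finrank ℝ V - 2 * n)).prod 𝓘(ℂ, Fin n → ℂ)) ω
      (fun W : OG V n => TotalSpace.mk' (Fin n → ℂ) W (univQuot W v)) := by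
  intro W₀
  rw [contMDiffAt_section]
  set b := wittBasisAt W₀
  have h1 : (fun W => (trivializationAt (Fin n → ℂ) (UnivFiber (V := V) (n := n)) W₀
      ⟨W, univQuot W v⟩).2) = fun W => b.coords W (univQuot W v) := rfl
  rw [h1]
  have h2 := b.contMDiffOn_comp_chart (g := fun p => fun i => b.frame p i v)
    (contDiff_pi.2 fun i => b.contDiff_frame (Module.Dual.eval ℂ _ v) i)
  refine (h2.congr fun W hW => ?_).contMDiffAt
    (b.isOpen_chart_source.mem_nhds (mem_chart_wittBasisAt W₀))
  ext i
  rw [b.coords_univQuot, b.localFrame_eq hW]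

end Universal

/-! ### Categories of manifolds -/

section Manifolds

/-- A manifold over `𝕜` of class `C^k`: finite-dimensional, without boundary, Hausdorff and second
countable. -/
structure Mfld (𝕜 : Type) [NontriviallyNormedField 𝕜] (k : WithTop ℕ∞) : Type (u + 1) where
  carrier : Type u
  model : Type
  [normedAddCommGroup : NormedAddCommGroup model]
  [normedSpace : NormedSpace 𝕜 model]
  [finiteDimensional : FiniteDimensional 𝕜 model]
  [topologicalSpace : TopologicalSpace carrier]
  [chartedSpace : ChartedSpace model carrier]
  [isManifold : IsManifold 𝓘(𝕜, model) k carrier]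
  [t2Space : T2Space carrier]
  [secondCountable : SecondCountableTopology carrier]

attribute [instance] Mfld.normedAddCommGroup Mfld.normedSpace Mfld.finiteDimensional
  Mfld.topologicalSpace Mfld.chartedSpace Mfld.isManifold Mfld.t2Space Mfld.secondCountable

/-- The category of real smooth manifolds and smooth maps. -/
abbrev RealMfld : Type (u + 1) := Mfld.{u} ℝ ∞

/-- The category of complex manifolds and holomorphic (that is, complex analytic) maps. -/
abbrev ComplexMfld : Type (u + 1) := Mfld.{u} ℂ ω

instance (𝕜 : Type) [NontriviallyNormedField 𝕜] (k : WithTop ℕ∞) :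
    Category.{u} (Mfld.{u} 𝕜 k) where
  Hom M N := ContMDiffMap 𝓘(𝕜, M.model) 𝓘(𝕜, N.model) M.carrier N.carrier k
  id _ := ⟨fun x => x, contMDiff_id⟩
  comp f g := ContMDiffMap.comp g f

/-- The `C^k` map that underlies a morphism of manifolds. -/
abbrev Mfld.map {𝕜 : Type} [NontriviallyNormedField 𝕜] {k : WithTop ℕ∞} {M N : Mfld.{u} 𝕜 k}
    (f : M ⟶ N) : ContMDiffMap 𝓘(𝕜, M.model) 𝓘(𝕜, N.model) M.carrier N.carrier k := f

section Restrict

variable {E F M : Type*} [NormedAddCommGroup E] [NormedSpace ℂ E] [NormedSpace ℝ E]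
  [IsScalarTower ℝ ℂ E] [NormedAddCommGroup F] [NormedSpace ℂ F] [NormedSpace ℝ F]
  [IsScalarTower ℝ ℂ F] [TopologicalSpace M] [ChartedSpace E M]

/-- A holomorphic map into a complex vector space is smooth as a map of real manifolds. -/
lemma contMDiffWithinAt_real {f : M → F} {s : Set M} {x : M}
    (h : ContMDiffWithinAt 𝓘(ℂ, E) 𝓘(ℂ, F) ω f s x) :
    ContMDiffWithinAt 𝓘(ℝ, E) 𝓘(ℝ, F) ∞ f s x := by
  rw [contMDiffWithinAt_iff] at h ⊢
  exact ⟨h.1, (h.2.restrict_scalars ℝ).of_le le_top⟩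

/-- A complex manifold is a real smooth manifold. -/
lemma isManifold_real [IsManifold 𝓘(ℂ, E) ω M] : IsManifold 𝓘(ℝ, E) ∞ M := by
  refine isManifold_of_contDiffOn _ _ _ fun e e' he he' => ?_
  have h : ContDiffOn ℂ ω (𝓘(ℂ, E) ∘ (e.symm.trans e') ∘ 𝓘(ℂ, E).symm)
    (𝓘(ℂ, E).symm ⁻¹' (e.symm.trans e').source ∩ Set.range 𝓘(ℂ, E)) :=
    (contDiffGroupoid ω 𝓘(ℂ, E)).compatible he he' |>.1
  exact (h.restrict_scalars ℝ).of_le le_top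

end Restrict

/-- The real smooth manifold underlying a complex manifold. -/
@[reducible] def Mfld.real (N : ComplexMfld.{u}) : RealMfld.{u} :=
  letI : NormedSpace ℝ N.model := NormedSpace.complexToReal
  haveI : FiniteDimensional ℝ N.model := FiniteDimensional.complexToReal N.model
  haveI : IsManifold 𝓘(ℝ, N.model) ∞ N.carrier := isManifold_real
  { carrier := N.carrier
    model := N.model }

end Manifolds

/-! ### Quotient bundles of trivial bundles -/

section Bundles

open Bundle

/-- A quotient bundle `M × X → E` of rank `r` of the trivial bundle with fibre the
finite-dimensional vector space `X`, in the category of `C^k` vector bundles on `M`. The bundle map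
`M × X → E` is given by the surjective linear maps `quot x : X → E_x`; that it is of class `C^k`
means that it sends the constant sections `v ∈ X` of `M × X` to `C^k` sections of `E`. -/
structure QuotientBundle {𝕜 : Type} [NontriviallyNormedField 𝕜] {k : WithTop ℕ∞}
    (M : Mfld.{u} 𝕜 k) (X : Type u) [AddCommGroup X] [Module 𝕜 X] (r : ℕ) : Type (u + 1) where
  fiberModel : Type
  [fiberModelGroup : NormedAddCommGroup fiberModel]
  [fiberModelSpace : NormedSpace 𝕜 fiberModel]
  [fiberModelFinite : FiniteDimensional 𝕜 fiberModel]
  finrank_eq : Module.finrank 𝕜 fiberModel = r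
  fiber : M.carrier → Type u
  [fiberGroup : ∀ x, AddCommGroup (fiber x)]
  [fiberModule : ∀ x, Module 𝕜 (fiber x)]
  [fiberTopology : ∀ x, TopologicalSpace (fiber x)]
  [totalTopology : TopologicalSpace (TotalSpace fiberModel fiber)]
  [fiberBundle : FiberBundle fiberModel fiber]
  [vectorBundle : VectorBundle 𝕜 fiberModel fiber]
  [contMDiffVectorBundle : ContMDiffVectorBundle k fiberModel fiber 𝓘(𝕜, M.model)]
  quot : ∀ x, X →ₗ[𝕜] fiber x
  quot_surjective : ∀ x, Function.Surjective (quot x)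
  contMDiff_quot : ∀ v, ContMDiff 𝓘(𝕜, M.model) (𝓘(𝕜, M.model).prod 𝓘(𝕜, fiberModel)) k
    (fun x => TotalSpace.mk' fiberModel x (quot x v))

attribute [instance] QuotientBundle.fiberModelGroup QuotientBundle.fiberModelSpace
  QuotientBundle.fiberModelFinite QuotientBundle.fiberGroup QuotientBundle.fiberModule
  QuotientBundle.fiberTopology QuotientBundle.totalTopology QuotientBundle.fiberBundle
  QuotientBundle.vectorBundle QuotientBundle.contMDiffVectorBundle

namespace QuotientBundle

variable {𝕜 : Type} [NontriviallyNormedField 𝕜] {k : WithTop ℕ∞} {M M' M'' : Mfld.{u} 𝕜 k}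
  {X : Type u} [AddCommGroup X] [Module 𝕜 X] {r : ℕ}

/-- The total space of a quotient bundle. -/
abbrev Total (E : QuotientBundle M X r) : Type u := TotalSpace E.fiberModel E.fiber

/-- An isomorphism `E ≅ E'` of quotient bundles of `M × X`: an isomorphism of `C^k` vector bundles
over the identity of `M` that commutes with the quotient maps from `M × X`. -/
structure Iso (E E' : QuotientBundle M X r) where
  equiv : ∀ x, E.fiber x ≃ₗ[𝕜] E'.fiber x
  contMDiff_equiv : ContMDiff (𝓘(𝕜, M.model).prod 𝓘(𝕜, E.fiberModel))
    (𝓘(𝕜, M.model).prod 𝓘(𝕜, E'.fiberModel)) k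
    (fun z : E.Total => (⟨z.1, equiv z.1 z.2⟩ : E'.Total))
  contMDiff_equiv_symm : ContMDiff (𝓘(𝕜, M.model).prod 𝓘(𝕜, E'.fiberModel))
    (𝓘(𝕜, M.model).prod 𝓘(𝕜, E.fiberModel)) k
    (fun z : E'.Total => (⟨z.1, (equiv z.1).symm z.2⟩ : E.Total))
  equiv_quot : ∀ x v, equiv x (E.quot x v) = E'.quot x v

/-- The identity isomorphism. -/
def Iso.refl (E : QuotientBundle M X r) : Iso E E where
  equiv _ := LinearEquiv.refl _ _
  contMDiff_equiv := contMDiff_id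
  contMDiff_equiv_symm := contMDiff_id
  equiv_quot _ _ := rfl

/-- The inverse isomorphism. -/
def Iso.symm {E E' : QuotientBundle M X r} (φ : Iso E E') : Iso E' E where
  equiv x := (φ.equiv x).symm
  contMDiff_equiv := φ.contMDiff_equiv_symm
  contMDiff_equiv_symm := φ.contMDiff_equiv
  equiv_quot x v := by rw [LinearEquiv.symm_apply_eq, φ.equiv_quot]

/-- The composition of isomorphisms. -/
def Iso.trans {E E' E'' : QuotientBundle M X r} (φ : Iso E E') (ψ : Iso E' E'') : Iso E E'' where
  equiv x := (φ.equiv x).trans (ψ.equiv x)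
  contMDiff_equiv := ψ.contMDiff_equiv.comp φ.contMDiff_equiv
  contMDiff_equiv_symm := φ.contMDiff_equiv_symm.comp ψ.contMDiff_equiv_symm
  equiv_quot x v := by
    rw [LinearEquiv.trans_apply, φ.equiv_quot, ψ.equiv_quot]

section PullbackLemmas

variable {B B' : Type*} {F : Type*} {E : B → Type*} [NormedAddCommGroup F] [NormedSpace 𝕜 F]
  [TopologicalSpace (TotalSpace F E)] [∀ x, TopologicalSpace (E x)] [∀ x, AddCommGroup (E x)]
  {EB : Type*} [NormedAddCommGroup EB] [NormedSpace 𝕜 EB] [TopologicalSpace B] [ChartedSpace EB B]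
  {EB' : Type*} [NormedAddCommGroup EB'] [NormedSpace 𝕜 EB'] [TopologicalSpace B']
  [ChartedSpace EB' B'] [FiberBundle F E]
  {EX : Type*} [NormedAddCommGroup EX] [NormedSpace 𝕜 EX] {HX : Type*} [TopologicalSpace HX]
  {IX : ModelWithCorners 𝕜 EX HX} {Y : Type*} [TopologicalSpace Y] [ChartedSpace HX Y]
  (f : ContMDiffMap 𝓘(𝕜, EB') 𝓘(𝕜, EB) B' B k)

/-- A map into the total space of a pullback bundle is of class `C^k` if and only if its
components in the base and in the total space of the original bundle are. -/
lemma contMDiff_pullback_iff (g : Y → TotalSpace F (f *ᵖ E)) :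
    ContMDiff IX (𝓘(𝕜, EB').prod 𝓘(𝕜, F)) k g ↔
      ContMDiff IX 𝓘(𝕜, EB') k (fun y => (g y).1) ∧
      ContMDiff IX (𝓘(𝕜, EB).prod 𝓘(𝕜, F)) k
        (fun y => (⟨f (g y).1, (g y).2⟩ : TotalSpace F E)) := by
  constructor
  · intro h
    have h1 : ContMDiff IX 𝓘(𝕜, EB') k (fun y => (g y).1) :=
      fun y => (contMDiffAt_totalSpace.1 (h y)).1
    refine ⟨h1, fun y => contMDiffAt_totalSpace.2 ⟨f.contMDiff.comp h1 y, ?_⟩⟩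
    exact (contMDiffAt_totalSpace.1 (h y)).2
  · rintro ⟨h1, h2⟩ y
    exact contMDiffAt_totalSpace.2 ⟨h1 y, (contMDiffAt_totalSpace.1 (h2 y)).2⟩

end PullbackLemmas

/-- The pullback of a quotient bundle of `M × X` by a morphism `M' → M`, a quotient bundle of
`M' × X`. -/
def pullback (f : M' ⟶ M) (E : QuotientBundle M X r) : QuotientBundle M' X r :=
  let f' := Mfld.map f
  { fiberModel := E.fiberModel
    finrank_eq := E.finrank_eq
    fiber := f' *ᵖ E.fiber
    fiberGroup := fun x => E.fiberGroup (f' x)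
    fiberModule := fun x => E.fiberModule (f' x)
    fiberTopology := fun x => E.fiberTopology (f' x)
    totalTopology := Pullback.TotalSpace.topologicalSpace E.fiberModel E.fiber f'
    fiberBundle := FiberBundle.pullback f'
    vectorBundle := VectorBundle.pullback 𝕜 (E := E.fiber) f'
    contMDiffVectorBundle := ContMDiffVectorBundle.pullback E.fiberModel E.fiber _ f'
    quot := fun x => E.quot (f' x)
    quot_surjective := fun x => E.quot_surjective (f' x)
    contMDiff_quot := fun v => (contMDiff_pullback_iff f' _).2
      ⟨contMDiff_id, (E.contMDiff_quot v).comp f'.contMDiff⟩ }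

lemma contMDiff_pullback_rec (f : M' ⟶ M) (E : QuotientBundle M X r) {EX : Type*}
    [NormedAddCommGroup EX] [NormedSpace 𝕜 EX] {HX : Type*} [TopologicalSpace HX]
    {IX : ModelWithCorners 𝕜 EX HX} {Y : Type*} [TopologicalSpace Y] [ChartedSpace HX Y]
    {g : Y → (E.pullback f).Total}
    (h1 : ContMDiff IX 𝓘(𝕜, M'.model) k (fun y => (g y).1))
    (h2 : ContMDiff IX (𝓘(𝕜, M.model).prod 𝓘(𝕜, E.fiberModel)) k
        (fun y => (⟨Mfld.map f (g y).1, (g y).2⟩ : E.Total))) :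
    ContMDiff IX (𝓘(𝕜, M'.model).prod 𝓘(𝕜, (E.pullback f).fiberModel)) k g :=
  (contMDiff_pullback_iff (F := E.fiberModel) (E := E.fiber)
    (Mfld.map f) g).2 ⟨h1, h2⟩

lemma contMDiff_pullback_lift (f : M' ⟶ M) (E : QuotientBundle M X r) :
    ContMDiff (𝓘(𝕜, M'.model).prod 𝓘(𝕜, (E.pullback f).fiberModel))
      (𝓘(𝕜, M.model).prod 𝓘(𝕜, E.fiberModel)) k
      (fun z : (E.pullback f).Total => (⟨Mfld.map f z.1, z.2⟩ : E.Total)) :=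
  ((contMDiff_pullback_iff (F := E.fiberModel) (E := E.fiber)
    (Mfld.map f) id).1
      contMDiff_id).2

lemma contMDiff_proj (E : QuotientBundle M X r) :
    ContMDiff (𝓘(𝕜, M.model).prod 𝓘(𝕜, E.fiberModel)) 𝓘(𝕜, M.model) k (fun z : E.Total => z.1) :=
  Bundle.contMDiff_proj E.fiber

/-- Isomorphisms can be pulled back. -/
def Iso.pullback (f : M' ⟶ M) {E E' : QuotientBundle M X r} (φ : Iso E E') :
    Iso (E.pullback f) (E'.pullback f) where
  equiv x := φ.equiv (Mfld.map f x)
  contMDiff_equiv := contMDiff_pullback_rec f E' (E.pullback f).contMDiff_proj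
    (φ.contMDiff_equiv.comp (E.contMDiff_pullback_lift f))
  contMDiff_equiv_symm := contMDiff_pullback_rec f E (E'.pullback f).contMDiff_proj
    (φ.contMDiff_equiv_symm.comp (E'.contMDiff_pullback_lift f))
  equiv_quot x v := φ.equiv_quot (Mfld.map f x) v

/-- The pullback by the identity. -/
def pullbackId (E : QuotientBundle M X r) : Iso (E.pullback (𝟙 M)) E where
  equiv x := LinearEquiv.refl 𝕜 (E.fiber x)
  contMDiff_equiv := E.contMDiff_pullback_lift (𝟙 M)
  contMDiff_equiv_symm := contMDiff_pullback_rec (𝟙 M) E E.contMDiff_proj contMDiff_id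
  equiv_quot _ _ := rfl

/-- The pullback by a composition. -/
def pullbackComp (f : M'' ⟶ M') (g : M' ⟶ M) (E : QuotientBundle M X r) :
    Iso (E.pullback (f ≫ g)) ((E.pullback g).pullback f) where
  equiv x := LinearEquiv.refl 𝕜 (E.fiber (Mfld.map g (Mfld.map f x)))
  contMDiff_equiv := contMDiff_pullback_rec f (E.pullback g) (E.pullback (f ≫ g)).contMDiff_proj
    (contMDiff_pullback_rec g E
      ((Mfld.map f).contMDiff.comp (E.pullback (f ≫ g)).contMDiff_proj)
      (E.contMDiff_pullback_lift (f ≫ g)))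
  contMDiff_equiv_symm := contMDiff_pullback_rec (f ≫ g) E
    ((E.pullback g).pullback f).contMDiff_proj
    ((E.contMDiff_pullback_lift g).comp ((E.pullback g).contMDiff_pullback_lift f))
  equiv_quot _ _ := rfl

end QuotientBundle

end Bundles

/-! ### Isotropic quotient bundles -/

section Isotropic

open Bundle

section Linear

variable {V : Type u} [NormedAddCommGroup V] [InnerProductSpace ℝ V] [FiniteDimensional ℝ V]

/-- A complex quotient `q : V_ℂ → Λ` is isotropic if `h_ℂ^*` vanishes identically on the image of
the dual embedding `Λ^* → V_ℂ^*`. -/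
def IsIsotropic {Λ : Type*} [AddCommGroup Λ] [Module ℂ Λ] (q : (ℂ ⊗[ℝ] V) →ₗ[ℂ] Λ) : Prop :=
  ∀ l l' : Module.Dual ℂ Λ, dualForm V (l ∘ₗ q) (l' ∘ₗ q) = 0

/-- A real quotient `q : V → Λ` with a complex structure `J` on `Λ` is isotropic if `h_ℂ^*` vanishes
identically on the image of `Λ^* → V_ℂ^*`. Here `Λ^*` consists of the `ℂ`-linear functionals on
`(Λ, J)`, and such a functional `l` is sent to the `ℂ`-linear extension of `l ∘ q : V → ℂ`. -/
def IsIsotropicReal {Λ : Type*} [AddCommGroup Λ] [Module ℝ Λ] (q : V →ₗ[ℝ] Λ) (J : Λ →ₗ[ℝ] Λ) :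
    Prop :=
  ∀ l l' : Λ →ₗ[ℝ] ℂ, (∀ y, l (J y) = Complex.I * l y) → (∀ y, l' (J y) = Complex.I * l' y) →
    dualForm V ((l ∘ₗ q).liftBaseChange ℂ) ((l' ∘ₗ q).liftBaseChange ℂ) = 0

/-- An isotropic quotient of `V_ℂ` is also a real quotient of `V`. -/
lemma IsIsotropic.real_surjective {Λ : Type*} [AddCommGroup Λ] [Module ℂ Λ]
    {q : (ℂ ⊗[ℝ] V) →ₗ[ℂ] Λ} (hq : IsIsotropic q) (hs : Function.Surjective q) :
    Function.Surjective (fun v : V => q (1 ⊗ₜ[ℝ] v)) := by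
  set q' : V →ₗ[ℝ] Λ := (q.restrictScalars ℝ) ∘ₗ (TensorProduct.mk ℝ ℂ V 1) with hq'
  suffices h : LinearMap.range q' = ⊤ from LinearMap.range_eq_top.1 h
  by_contra hne
  obtain ⟨g, hg, hle⟩ := Submodule.exists_le_ker_of_lt_top _ (lt_top_iff_ne_top.2 hne)
  set l : Module.Dual ℂ Λ := Module.Dual.extendRCLike (𝕜 := ℂ) g with hl
  have hre : ∀ y, (l y).re = g y := fun y => by
    simp [hl, Module.Dual.extendRCLike_apply]
  have hre0 : ∀ i, (l (q (1 ⊗ₜ[ℝ] stdOrthonormalBasis ℝ V i))).re = 0 := fun i => by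
    rw [hre]
    exact hle ⟨stdOrthonormalBasis ℝ V i, rfl⟩
  have h0 := hq l l
  rw [dualForm_apply] at h0
  have h1 : ∑ i, (l (q (1 ⊗ₜ[ℝ] stdOrthonormalBasis ℝ V i))).im ^ 2 = 0 := by
    have := congrArg Complex.re h0
    simp only [LinearMap.comp_apply, Complex.re_sum, Complex.mul_re, hre0, Complex.zero_re] at this
    rw [← neg_eq_zero, ← Finset.sum_neg_distrib, ← this]
    exact Finset.sum_congr rfl fun i _ => by ring
  have h2 : ∀ i, (l (q (1 ⊗ₜ[ℝ] stdOrthonormalBasis ℝ V i))).im = 0 := fun i =>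
    pow_eq_zero_iff two_ne_zero |>.1
      ((Finset.sum_eq_zero_iff_of_nonneg fun i _ => sq_nonneg _).1 h1 i (Finset.mem_univ i))
  have h3 : l ∘ₗ q = 0 := cdual_ext fun i => by
    refine Complex.ext ?_ ?_
    · simpa using hre0 i
    · simpa using h2 i
  apply hg
  ext y
  obtain ⟨v, rfl⟩ := hs y
  rw [← hre]
  have := LinearMap.congr_fun h3 v
  rw [LinearMap.comp_apply] at this
  simp [this]

end Linear

variable (V : Type u) [NormedAddCommGroup V] [InnerProductSpace ℝ V] [FiniteDimensional ℝ V]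
  (n : ℕ)

/-- An almost-complex isotropic quotient bundle of rank `2n` of `M × V`: a smooth real quotient
bundle `M × V → E` of rank `2n` together with a smooth endomorphism `J` of `E` with `J² = -1`, such
that every fibre is an isotropic quotient of `V`. -/
structure AlmostComplexIsotropicQuotient (M : RealMfld.{u}) extends
    QuotientBundle M V (2 * n) where
  J : ∀ x, fiber x →ₗ[ℝ] fiber x
  contMDiff_J : ContMDiff (𝓘(ℝ, M.model).prod 𝓘(ℝ, fiberModel))
    (𝓘(ℝ, M.model).prod 𝓘(ℝ, fiberModel)) ∞
    (fun z : TotalSpace fiberModel fiber => (⟨z.1, J z.1 z.2⟩ : TotalSpace fiberModel fiber))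
  J_sq : ∀ x y, J x (J x y) = -y
  isotropic : ∀ x, IsIsotropicReal (quot x) (J x)

/-- An isotropic holomorphic quotient bundle of rank `n` of `N × V_ℂ`: a holomorphic quotient
bundle `N × V_ℂ → E` of rank `n` such that every fibre is an isotropic quotient of `V_ℂ`. -/
structure HolomorphicIsotropicQuotient (N : ComplexMfld.{u}) extends
    QuotientBundle N (ℂ ⊗[ℝ] V) n where
  isotropic : ∀ x, IsIsotropic (quot x)

variable {V n}

namespace AlmostComplexIsotropicQuotient

variable {M M' : RealMfld.{u}}

/-- Isomorphism of almost-complex isotropic quotient bundles: the isomorphism of bundles commutes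
with the quotient maps and with the almost complex structures. -/
def Isomorphic (E E' : AlmostComplexIsotropicQuotient V n M) : Prop :=
  ∃ φ : QuotientBundle.Iso E.toQuotientBundle E'.toQuotientBundle,
    ∀ x y, φ.equiv x (E.J x y) = E'.J x (φ.equiv x y)

lemma isomorphic_equivalence :
    Equivalence (Isomorphic : AlmostComplexIsotropicQuotient V n M → _ → Prop) where
  refl E := ⟨.refl _, fun _ _ => rfl⟩
  symm := by
    rintro E E' ⟨φ, h⟩
    refine ⟨φ.symm, fun x y => ?_⟩
    change (φ.equiv x).symm _ = E.J x ((φ.equiv x).symm y)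
    rw [LinearEquiv.symm_apply_eq, h, LinearEquiv.apply_symm_apply]
  trans := by
    rintro E E' E'' ⟨φ, h⟩ ⟨ψ, h'⟩
    refine ⟨φ.trans ψ, fun x y => ?_⟩
    change ψ.equiv x (φ.equiv x _) = E''.J x (ψ.equiv x (φ.equiv x y))
    rw [h, h']

/-- The pullback of an almost-complex isotropic quotient bundle by a smooth map. -/
def pullback (f : M' ⟶ M) (E : AlmostComplexIsotropicQuotient V n M) :
    AlmostComplexIsotropicQuotient V n M' where
  toQuotientBundle := E.toQuotientBundle.pullback f
  J x := E.J (Mfld.map f x)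
  contMDiff_J := QuotientBundle.contMDiff_pullback_rec f E.toQuotientBundle
    (E.toQuotientBundle.pullback f).contMDiff_proj
    (E.contMDiff_J.comp (E.toQuotientBundle.contMDiff_pullback_lift f))
  J_sq x := E.J_sq (Mfld.map f x)
  isotropic x := E.isotropic (Mfld.map f x)

/-- The setoid of isomorphism of almost-complex isotropic quotient bundles. -/
def setoid (V : Type u) [NormedAddCommGroup V] [InnerProductSpace ℝ V] [FiniteDimensional ℝ V]
    (n : ℕ) (M : RealMfld.{u}) : Setoid (AlmostComplexIsotropicQuotient V n M) :=
  ⟨Isomorphic, isomorphic_equivalence⟩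

/-- The contravariant functor that sends a real manifold `M` to the set of isomorphism classes of
almost-complex isotropic quotient bundles of rank `2n` of `M × V`, and a smooth map to the
pullback. -/
def isoClasses (V : Type u) [NormedAddCommGroup V] [InnerProductSpace ℝ V]
    [FiniteDimensional ℝ V] (n : ℕ) : RealMfld.{u}ᵒᵖ ⥤ Type (u + 1) where
  obj M := Quotient (setoid V n M.unop)
  map f := TypeCat.ofHom (Quotient.map (pullback f.unop) (by
    rintro E E' ⟨φ, h⟩
    exact ⟨φ.pullback f.unop, fun x y => h (Mfld.map f.unop x) y⟩))
  map_id M := by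
    ext c
    induction c using Quotient.inductionOn with
    | h E => exact Quotient.sound ⟨E.toQuotientBundle.pullbackId, fun _ _ => rfl⟩
  map_comp f g := by
    ext c
    induction c using Quotient.inductionOn with
    | h E => exact Quotient.sound ⟨E.toQuotientBundle.pullbackComp g.unop f.unop, fun _ _ => rfl⟩

/-- The isomorphism class of an almost-complex isotropic quotient bundle. -/
def isoClass (E : AlmostComplexIsotropicQuotient V n M) :
    (isoClasses V n).obj (Opposite.op M) := Quotient.mk (setoid V n M) E

end AlmostComplexIsotropicQuotient

namespace HolomorphicIsotropicQuotient

variable {N N' : ComplexMfld.{u}}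

/-- Isomorphism of isotropic holomorphic quotient bundles: the isomorphism of holomorphic bundles
commutes with the quotient maps. -/
def Isomorphic (E E' : HolomorphicIsotropicQuotient V n N) : Prop :=
  Nonempty (QuotientBundle.Iso E.toQuotientBundle E'.toQuotientBundle)

lemma isomorphic_equivalence :
    Equivalence (Isomorphic : HolomorphicIsotropicQuotient V n N → _ → Prop) where
  refl _ := ⟨.refl _⟩
  symm := fun ⟨φ⟩ => ⟨φ.symm⟩
  trans := fun ⟨φ⟩ ⟨ψ⟩ => ⟨φ.trans ψ⟩

/-- The pullback of an isotropic holomorphic quotient bundle by a holomorphic map. -/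
def pullback (f : N' ⟶ N) (E : HolomorphicIsotropicQuotient V n N) :
    HolomorphicIsotropicQuotient V n N' where
  toQuotientBundle := E.toQuotientBundle.pullback f
  isotropic x := E.isotropic (Mfld.map f x)

/-- The setoid of isomorphism of isotropic holomorphic quotient bundles. -/
def setoid (V : Type u) [NormedAddCommGroup V] [InnerProductSpace ℝ V] [FiniteDimensional ℝ V]
    (n : ℕ) (N : ComplexMfld.{u}) : Setoid (HolomorphicIsotropicQuotient V n N) :=
  ⟨Isomorphic, isomorphic_equivalence⟩

/-- The contravariant functor that sends a complex manifold `N` to the set of isomorphism classes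
of isotropic holomorphic quotient bundles of rank `n` of `N × V_ℂ`, and a holomorphic map to the
pullback. -/
def isoClasses (V : Type u) [NormedAddCommGroup V] [InnerProductSpace ℝ V]
    [FiniteDimensional ℝ V] (n : ℕ) : ComplexMfld.{u}ᵒᵖ ⥤ Type (u + 1) where
  obj N := Quotient (setoid V n N.unop)
  map f := TypeCat.ofHom (Quotient.map (pullback f.unop)
    (fun _ _ ⟨φ⟩ => ⟨φ.pullback f.unop⟩))
  map_id N := by
    ext c
    induction c using Quotient.inductionOn with
    | h E => exact Quotient.sound ⟨E.toQuotientBundle.pullbackId⟩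
  map_comp f g := by
    ext c
    induction c using Quotient.inductionOn with
    | h E => exact Quotient.sound ⟨E.toQuotientBundle.pullbackComp g.unop f.unop⟩

/-- The isomorphism class of an isotropic holomorphic quotient bundle. -/
def isoClass (E : HolomorphicIsotropicQuotient V n N) :
    (isoClasses V n).obj (Opposite.op N) := Quotient.mk (setoid V n N) E

end HolomorphicIsotropicQuotient

end Isotropic

/-! ### Realification -/

section Realification

open Bundle

section General

variable {E F B : Type*} {X : B → Type*} [NormedAddCommGroup E] [NormedSpace ℂ E] [NormedSpace ℝ E]
  [IsScalarTower ℝ ℂ E] [NormedAddCommGroup F] [NormedSpace ℂ F] [NormedSpace ℝ F]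
  [IsScalarTower ℝ ℂ F] [TopologicalSpace B] [ChartedSpace E B] [∀ x, AddCommGroup (X x)]
  [∀ x, Module ℂ (X x)] [∀ x, Module ℝ (X x)] [∀ x, IsScalarTower ℝ ℂ (X x)]
  [∀ x, TopologicalSpace (X x)] [TopologicalSpace (TotalSpace F X)] [FiberBundle F X]

lemma isLinear_real (e : Trivialization F (π F X)) (h : e.IsLinear ℂ) : e.IsLinear ℝ where
  linear b hb :=
    { map_add := (h.linear b hb).map_add
      map_smul := fun c y => by
        have := (h.linear b hb).map_smul (c : ℂ) y
        have e1 : ∀ y : X b, c • y = (c : ℂ) • y := fun y => by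
          rw [← one_smul ℂ y, ← smul_assoc]; simp
        have e2 : ∀ y : F, c • y = (c : ℂ) • y := fun y => by
          rw [← one_smul ℂ y, ← smul_assoc]; simp
        rw [e1, e2]
        exact this }

lemma coordChangeL_real [VectorBundle ℂ F X] (hR : ∀ (e : Trivialization F (π F X))
    [MemTrivializationAtlas e], e.IsLinear ℝ) (e e' : Trivialization F (π F X))
    [MemTrivializationAtlas e] [MemTrivializationAtlas e'] {b : B}
    (hb : b ∈ e.baseSet ∩ e'.baseSet) :
    haveI := hR e
    haveI := hR e'
    ((e.coordChangeL ℝ e' b : F ≃L[ℝ] F) : F →L[ℝ] F) =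
      ContinuousLinearMap.restrictScalars ℝ (e.coordChangeL ℂ e' b : F →L[ℂ] F) := by
  have := hR e
  have := hR e'
  ext v
  change e.coordChangeL ℝ e' b v = e.coordChangeL ℂ e' b v
  rw [e.coordChangeL_apply e' hb, e.coordChangeL_apply e' hb]

/-- A complex vector bundle is a real vector bundle. -/
lemma vectorBundle_real [VectorBundle ℂ F X] : VectorBundle ℝ F X where
  trivialization_linear' e _ := isLinear_real e inferInstance
  continuousOn_coordChange' e e' _ _ := by
    have hc := continuousOn_coordChange ℂ e e'
    refine ((ContinuousLinearMap.restrictScalarsL ℂ F F ℝ ℝ).continuous.comp_continuousOn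
      hc).congr fun b hb => ?_
    exact coordChangeL_real (fun e _ => isLinear_real e inferInstance)
      e e' hb

/-- A holomorphic vector bundle is a smooth real vector bundle. -/
lemma contMDiffVectorBundle_real [VectorBundle ℂ F X] [VectorBundle ℝ F X]
    [ContMDiffVectorBundle ω F X 𝓘(ℂ, E)] : ContMDiffVectorBundle ∞ F X 𝓘(ℝ, E) where
  contMDiffOn_coordChangeL e e' _ _ := by
    have hc := contMDiffOn_coordChangeL (n := ω) (IB := 𝓘(ℂ, E)) (𝕜 := ℂ) e e'
    have h1 : ContMDiffOn 𝓘(ℝ, E) 𝓘(ℝ, F →L[ℂ] F) ∞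
        (fun b => (e.coordChangeL ℂ e' b : F →L[ℂ] F)) (e.baseSet ∩ e'.baseSet) :=
      fun b hb => contMDiffWithinAt_real (hc b hb)
    refine ((ContinuousLinearMap.restrictScalarsL ℂ F F ℝ ℝ).contDiff.contMDiff.comp_contMDiffOn
      h1).congr fun b hb => ?_
    exact coordChangeL_real (fun e _ => isLinear_real e inferInstance)
      e e' hb

/-- A holomorphic section is smooth. -/
lemma contMDiff_section_real {s : ∀ x, X x}
    (h : ContMDiff 𝓘(ℂ, E) (𝓘(ℂ, E).prod 𝓘(ℂ, F)) ω (fun x => TotalSpace.mk' F x (s x))) :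
    ContMDiff 𝓘(ℝ, E) (𝓘(ℝ, E).prod 𝓘(ℝ, F)) ∞ (fun x => TotalSpace.mk' F x (s x)) := by
  intro x
  have := (contMDiffAt_section x).1 (h x)
  exact (contMDiffAt_section x).2 (contMDiffWithinAt_real this)

/-- Multiplication by `i` is a smooth endomorphism of a complex vector bundle. -/
lemma contMDiff_smul_I [VectorBundle ℂ F X] :
    ContMDiff (𝓘(ℝ, E).prod 𝓘(ℝ, F)) (𝓘(ℝ, E).prod 𝓘(ℝ, F)) ∞
      (fun z : TotalSpace F X => (⟨z.1, Complex.I • z.2⟩ : TotalSpace F X)) := by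
  intro z₀
  refine contMDiffAt_totalSpace.2 ⟨(contMDiff_proj X) z₀, ?_⟩
  set e := trivializationAt F X z₀.1
  have h1 := (contMDiffAt_totalSpace.1
    (contMDiffAt_id (I := 𝓘(ℝ, E).prod 𝓘(ℝ, F)) (n := ∞) (x := z₀))).2
  have h2 : ContMDiffAt (𝓘(ℝ, E).prod 𝓘(ℝ, F)) 𝓘(ℝ, F) ∞
      (fun z : TotalSpace F X => Complex.I • (e z).2) z₀ :=
    ((Complex.I • ContinuousLinearMap.id ℂ F).restrictScalars ℝ).contDiff.contMDiff.contMDiffAt.comp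
      z₀ h1
  refine h2.congr_of_eventuallyEq ?_
  have hopen : e.source ∈ nhds z₀ := e.open_source.mem_nhds
    (e.mem_source.2 (FiberBundle.mem_baseSet_trivializationAt' z₀.1))
  filter_upwards [hopen] with z hz
  exact ((e.linear ℂ (e.mem_source.1 hz)).map_smul Complex.I z.2)

end General

variable {V : Type u} [NormedAddCommGroup V] [InnerProductSpace ℝ V] [FiniteDimensional ℝ V]
  {n : ℕ}

/-- The realification of an isotropic holomorphic quotient `N × V_ℂ → E`: the bundle `E` regarded
as a real bundle, with the restriction `N × V → E` of the quotient map and with multiplication by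
`i` as almost complex structure. -/
def HolomorphicIsotropicQuotient.real {N : ComplexMfld.{u}}
    (E : HolomorphicIsotropicQuotient V n N) : AlmostComplexIsotropicQuotient V n N.real :=
  letI : NormedSpace ℝ N.model := NormedSpace.complexToReal
  letI : NormedSpace ℝ E.fiberModel := NormedSpace.complexToReal
  letI : ∀ x, Module ℝ (E.fiber x) := fun x => Module.complexToReal (E.fiber x)
  { fiberModel := E.fiberModel
    fiberModelFinite := FiniteDimensional.complexToReal E.fiberModel
    finrank_eq := by rw [finrank_real_of_complex, E.finrank_eq]
    fiber := E.fiber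
    vectorBundle := vectorBundle_real
    contMDiffVectorBundle :=
      haveI : VectorBundle ℝ E.fiberModel E.fiber := vectorBundle_real
      contMDiffVectorBundle_real
    quot := fun x => ((E.quot x).restrictScalars ℝ) ∘ₗ (TensorProduct.mk ℝ ℂ V 1)
    quot_surjective := fun x => (E.isotropic x).real_surjective (E.quot_surjective x)
    contMDiff_quot := fun v => contMDiff_section_real (E.contMDiff_quot (1 ⊗ₜ[ℝ] v))
    J := fun x => (Complex.I • (LinearMap.id : E.fiber x →ₗ[ℂ] E.fiber x)).restrictScalars ℝ
    contMDiff_J := contMDiff_smul_I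
    J_sq := fun x y => by
      change Complex.I • Complex.I • y = -y
      rw [smul_smul, Complex.I_mul_I, neg_one_smul]
    isotropic := fun x l l' hl hl' => by
      have key : ∀ l : E.fiber x →ₗ[ℝ] ℂ, (∀ y, l (Complex.I • y) = Complex.I * l y) →
          ∃ L : Module.Dual ℂ (E.fiber x), ∀ y, L y = l y := by
        intro l hl
        refine ⟨{ toFun := l, map_add' := l.map_add, map_smul' := fun c y => ?_ }, fun y => rfl⟩
        have hc : c • y = c.re • y + c.im • (Complex.I • y) := by
          conv_lhs => rw [← Complex.re_add_im c]
          rw [add_smul, mul_smul, Complex.coe_smul, Complex.coe_smul]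
        rw [hc, map_add, map_smul, map_smul, hl]
        conv_rhs => rw [RingHom.id_apply, ← Complex.re_add_im c]
        simp only [Complex.real_smul, smul_eq_mul]
        ring
      obtain ⟨L, hL⟩ := key l hl
      obtain ⟨L', hL'⟩ := key l' hl'
      have h := E.isotropic x L L'
      rw [dualForm_apply] at h ⊢
      rw [← h]
      refine Finset.sum_congr rfl fun i _ => ?_
      simp only [LinearMap.comp_apply, hL, hL', LinearMap.liftBaseChange_tmul, one_smul]
      rfl }

end Realification

/-! ### The orthogonal Grassmannian as a manifold and its universal bundles -/

section Final

open Bundle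

variable (V : Type u) [NormedAddCommGroup V] [InnerProductSpace ℝ V] [FiniteDimensional ℝ V]
  (n : ℕ)

/-- The orthogonal Grassmannian as a complex manifold. -/
@[reducible] def grassmannian : ComplexMfld.{u} where
  carrier := OG V n
  model := Model n (Module.finrank ℝ V - 2 * n)

/-- The universal quotient bundle `𝔔` of the orthogonal Grassmannian, whose fibre at `Λ^*` is the
quotient `Λ` of `V_ℂ`. -/
def universalHolomorphic : HolomorphicIsotropicQuotient V n (grassmannian V n) where
  fiberModel := Fin n → ℂ
  finrank_eq := by simp
  fiber := UnivFiber (V := V) (n := n)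
  fiberBundle := inferInstanceAs (FiberBundle (Fin n → ℂ) (UnivFiber (V := V) (n := n)))
  vectorBundle := inferInstanceAs (VectorBundle ℂ (Fin n → ℂ) (UnivFiber (V := V) (n := n)))
  contMDiffVectorBundle := inferInstanceAs (ContMDiffVectorBundle ω (Fin n → ℂ)
    (UnivFiber (V := V) (n := n)) 𝓘(ℂ, Model n (Module.finrank ℝ V - 2 * n)))
  quot := univQuot
  quot_surjective := univQuot_surjective
  contMDiff_quot := contMDiff_univQuot
  isotropic W l l' := by
    have key : ∀ l : Module.Dual ℂ (UnivFiber W), l ∘ₗ univQuot W ∈ W.1 := by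
      intro l
      rw [← Subspace.dualCoannihilator_dualAnnihilator_eq (W := W.1),
        Submodule.mem_dualAnnihilator]
      intro v hv
      have : univQuot W v = 0 := (Submodule.Quotient.mk_eq_zero _).2 hv
      rw [LinearMap.comp_apply, this, map_zero]
    exact W.2.2 _ (key l) _ (key l')

/-- The realification `𝒬` of the universal quotient bundle `𝔔`. -/
def universalReal : AlmostComplexIsotropicQuotient V n (grassmannian V n).real :=
  (universalHolomorphic V n).real

end Final

end OrthogonalGrassmannian

end

/-! A surjection `q : V_ℂ → Λ` is determined up to isomorphism by its kernel, hence by the image of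
the dual embedding `Λ^* → V_ℂ^*`, which is the annihilator of that kernel. Isotropy of `q` says
exactly that this `n`-dimensional image is a point of `OG V n`, and the universal fibre over a point
`W` is the quotient by the common kernel of `W`. Over a point, then, isomorphism classes of
isotropic quotients and points of the Grassmannian are the same thing.

For a bundle, the only candidate for the classifying map sends `x` to the image of the dual of
`q_x`. Uniqueness follows because an isomorphism compatible with the quotient maps does not change
the image (`range_dualMap_of_equiv`), while the image for the universal fibre over `W` is `W` itself
(`range_dualMap_univQuot`). For existence the fibrewise isomorphisms are at hand (`fiberEquiv`), and
two questions of regularity remain.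

The first is that the isomorphism is of class `C^k` in the total space. This is automatic: near any
point finitely many constant sections form a frame of `E`, and a map commuting with the quotient
maps has prescribed values on them (`contMDiff_of_comp_quot`). The second is that the classifying
map is regular. It suffices to find a local frame of the subspaces whose values on constant vectors
are regular, because the chart coordinates of a span are rational functions of those values
(`contMDiffAt_of_frame`, `contMDiffAt_real_of_frame`).

In the almost-complex case `J_x` makes each fibre an `n`-dimensional complex space and `q_x` extends
to an isotropic quotient of `V_ℂ`, so the same linear algebra applies. The frame needs more care,
since trivializations are only real linear: functionals that are constant in a trivialization are
projected to their `J_x`-linear parts. Representability is then the Yoneda lemma. -/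

noncomputable section

open Bundle

namespace OrthogonalGrassmannian

universe u

/-! ### Bundle maps that commute with the quotient maps are automatically regular -/

namespace QuotientBundle

variable {𝕜 : Type} [NontriviallyNormedField 𝕜] {k : WithTop ℕ∞} {M : Mfld.{u} 𝕜 k}
  {X : Type u} [AddCommGroup X] [Module 𝕜 X] {r : ℕ}

/-- The value of the section `v`, in the local trivialization of `E` at `x₀`. -/
def localQuot (E : QuotientBundle M X r) (x₀ x : M.carrier) : X →ₗ[𝕜] E.fiberModel :=
  ((trivializationAt E.fiberModel E.fiber x₀).linearMapAt 𝕜 x) ∘ₗ E.quot x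

lemma localQuot_apply (E : QuotientBundle M X r) {x₀ x : M.carrier}
    (hx : x ∈ (trivializationAt E.fiberModel E.fiber x₀).baseSet) (v : X) :
    E.localQuot x₀ x v = (trivializationAt E.fiberModel E.fiber x₀ ⟨x, E.quot x v⟩).2 := by
  rw [localQuot, LinearMap.comp_apply,
    (trivializationAt E.fiberModel E.fiber x₀).linearMapAt_apply, if_pos hx]

lemma baseSet_mem_nhds (E : QuotientBundle M X r) (x₀ : M.carrier) :
    (trivializationAt E.fiberModel E.fiber x₀).baseSet ∈ nhds x₀ :=
  (trivializationAt E.fiberModel E.fiber x₀).open_baseSet.mem_nhds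
    (FiberBundle.mem_baseSet_trivializationAt' x₀)

lemma contMDiffAt_localQuot (E : QuotientBundle M X r) (x₀ : M.carrier) (v : X) :
    ContMDiffAt 𝓘(𝕜, M.model) 𝓘(𝕜, E.fiberModel) k (fun x => E.localQuot x₀ x v) x₀ := by
  refine ((contMDiffAt_section x₀).1 (E.contMDiff_quot v x₀)).congr_of_eventuallyEq ?_
  filter_upwards [E.baseSet_mem_nhds x₀] with x hx
  exact E.localQuot_apply hx v

lemma localQuot_surjective (E : QuotientBundle M X r) {x₀ x : M.carrier}
    (hx : x ∈ (trivializationAt E.fiberModel E.fiber x₀).baseSet) :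
    Function.Surjective (E.localQuot x₀ x) := by
  intro y
  set e := trivializationAt E.fiberModel E.fiber x₀
  obtain ⟨v, hv⟩ := E.quot_surjective x ((e.linearEquivAt 𝕜 x hx).symm y)
  refine ⟨v, ?_⟩
  rw [E.localQuot_apply hx, hv]
  exact (e.linearEquivAt 𝕜 x hx).apply_symm_apply y

/-- The combinations of the sections given by the vectors `v`, in a local trivialization. -/
def combination (E : QuotientBundle M X r) {ι : Type} [Fintype ι] (v : ι → X)
    (x₀ x : M.carrier) : (ι → 𝕜) →L[𝕜] E.fiberModel :=
  ∑ j, (ContinuousLinearMap.proj (R := 𝕜) (φ := fun _ : ι => 𝕜) j).smulRight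
    (E.localQuot x₀ x (v j))

lemma combination_apply (E : QuotientBundle M X r) {ι : Type} [Fintype ι] (v : ι → X)
    (x₀ x : M.carrier) (c : ι → 𝕜) :
    E.combination v x₀ x c = E.localQuot x₀ x (∑ j, c j • v j) := by
  simp [combination]

/-- Regularity of each single section gives regularity in the operator norm, because the combination
is a finite sum of rank-one operators, each a continuous linear function of one section. The
operator-valued form is what allows inversion afterwards. -/
lemma contMDiffAt_combination (E : QuotientBundle M X r) {ι : Type} [Fintype ι] (v : ι → X)
    (x₀ : M.carrier) : ContMDiffAt 𝓘(𝕜, M.model) 𝓘(𝕜, (ι → 𝕜) →L[𝕜] E.fiberModel) k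
      (E.combination v x₀) x₀ := by
  unfold combination
  refine ContMDiffAt.sum fun j _ => ?_
  exact ((ContinuousLinearMap.smulRightL 𝕜 (ι → 𝕜) E.fiberModel
    (ContinuousLinearMap.proj j)).contDiff.contMDiff.contMDiffAt).comp x₀
    (E.contMDiffAt_localQuot x₀ (v j))

variable [CompleteSpace 𝕜]

/-- A family of linear maps between the fibres of two quotient bundles that commutes with the
quotient maps is a bundle map of class `C^k`. -/
lemma contMDiff_of_comp_quot (E E' : QuotientBundle M X r)
    (φ : ∀ x, E.fiber x →ₗ[𝕜] E'.fiber x) (hφ : ∀ x v, φ x (E.quot x v) = E'.quot x v) :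
    ContMDiff (𝓘(𝕜, M.model).prod 𝓘(𝕜, E.fiberModel))
      (𝓘(𝕜, M.model).prod 𝓘(𝕜, E'.fiberModel)) k
      (fun z : E.Total => (⟨z.1, φ z.1 z.2⟩ : E'.Total)) := by
  intro z₀
  refine contMDiffAt_totalSpace.2 ⟨E.contMDiff_proj z₀, ?_⟩
  set x₀ := z₀.1 with hx₀
  have hmem := E.baseSet_mem_nhds x₀
  let B := Module.finBasis 𝕜 E.fiberModel
  -- The vectors are chosen at `x₀` alone, as preimages of a basis of the model fibre. The
  -- associated combination is thus invertible at `x₀`, and therefore at all nearby points.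
  choose v hv using fun j => E.localQuot_surjective (mem_of_mem_nhds hmem) (B j)
  have h0 : E.combination v x₀ x₀ = (B.equivFunL.symm : _ →L[𝕜] E.fiberModel) := by
    ext c
    rw [combination_apply, map_sum]
    simp only [map_smul, hv]
    exact (B.equivFun_symm_apply c).symm
  have hT := E.contMDiffAt_combination v x₀
  -- `ContinuousLinearMap.inverse` is zero on non-invertible operators, but it is of class `C^k`
  -- near an invertible one; completeness of the field enters here.
  have hinv : ContMDiffAt 𝓘(𝕜, M.model) 𝓘(𝕜, E.fiberModel →L[𝕜] (Fin (Module.finrank 𝕜 E.fiberModel) → 𝕜)) k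
      (fun x => (E.combination v x₀ x).inverse) x₀ := by
    refine ContMDiffAt.comp x₀ (g := ContinuousLinearMap.inverse) ?_ hT
    rw [h0]
    exact (contDiffAt_map_inverse _).contMDiffAt
  have hproj := E.contMDiff_proj z₀
  have hsnd := (contMDiffAt_totalSpace.1
    (contMDiffAt_id (I := 𝓘(𝕜, M.model).prod 𝓘(𝕜, E.fiberModel)) (n := k) (x := z₀))).2
  -- In the trivializations, and with `T`, `T'` the combinations for `E` and `E'`, the bundle map is
  -- `T' ∘ T⁻¹` near `z₀`: the first factor reads off coefficients in the frame of constant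
  -- sections, the second uses the same coefficients in `E'`.
  have hmain := ((E'.contMDiffAt_combination v x₀).comp z₀ hproj).clm_apply
    ((hinv.comp z₀ hproj).clm_apply hsnd)
  refine hmain.congr_of_eventuallyEq ?_
  have hcont : Filter.Tendsto (fun z : E.Total => z.1) (nhds z₀) (nhds x₀) :=
    hproj.continuousAt
  have hunit : ∀ᶠ x in nhds x₀, E.combination v x₀ x ∈
      Set.range ((↑) : ((Fin (Module.finrank 𝕜 E.fiberModel) → 𝕜) ≃L[𝕜] E.fiberModel) → _) :=
    hT.continuousAt.eventually (h0 ▸ ContinuousLinearEquiv.nhds B.equivFunL.symm)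
  filter_upwards [hcont.eventually hunit, hcont.eventually hmem,
    hcont.eventually (E'.baseSet_mem_nhds x₀)] with z hz hz1 hz2
  obtain ⟨L, hL⟩ := hz
  set e := trivializationAt E.fiberModel E.fiber x₀ with he
  set c := L.symm (e z).2 with hc
  -- The vector `z.2` is the class of a constant vector with coefficients `c`, so the compatibility
  -- of `φ` with the quotient maps computes its image.
  have hzc : E.quot z.1 (∑ j, c j • v j) = z.2 := by
    refine (e.linearEquivAt 𝕜 z.1 hz1).injective ?_
    have h1 : E.combination v x₀ z.1 c = (e z).2 := by
      rw [← hL]; exact L.apply_symm_apply _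
    rw [combination_apply, E.localQuot_apply hz1] at h1
    exact h1
  have hgoal : (E.combination v x₀ z.1).inverse (e z).2 = c := by
    rw [← hL, ContinuousLinearMap.inverse_equiv]; rfl
  change (trivializationAt E'.fiberModel E'.fiber x₀ ⟨z.1, φ z.1 z.2⟩).2 =
    E'.combination v x₀ z.1 ((E.combination v x₀ z.1).inverse (e z).2)
  rw [hgoal, combination_apply, E'.localQuot_apply hz2, ← hzc, hφ]

/-- Linear isomorphisms between the fibres that commute with the quotient maps form an isomorphism
of quotient bundles. -/
def Iso.ofEquiv {E E' : QuotientBundle M X r} (φ : ∀ x, E.fiber x ≃ₗ[𝕜] E'.fiber x)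
    (hφ : ∀ x v, φ x (E.quot x v) = E'.quot x v) : Iso E E' where
  equiv := φ
  contMDiff_equiv := contMDiff_of_comp_quot E E' (fun x => φ x) hφ
  contMDiff_equiv_symm := contMDiff_of_comp_quot E' E (fun x => (φ x).symm) fun x v => by
    rw [LinearEquiv.coe_coe, LinearEquiv.symm_apply_eq, hφ]
  equiv_quot := hφ

end QuotientBundle

/-! ### Isotropic quotients of `V_ℂ` and isotropic subspaces of the dual -/

section Points

variable {V : Type u} [NormedAddCommGroup V] [InnerProductSpace ℝ V]
  {n : ℕ} {Λ : Type*} [AddCommGroup Λ] [Module ℂ Λ]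

/-- Double annihilator: the functionals that factor through `q` are those vanishing on its kernel,
and their common zeros give the kernel back. -/
lemma dualCoannihilator_range_dualMap (q : (ℂ ⊗[ℝ] V) →ₗ[ℂ] Λ) :
    (LinearMap.range q.dualMap).dualCoannihilator = LinearMap.ker q := by
  rw [LinearMap.range_dualMap_eq_dualAnnihilator_ker,
    Subspace.dualAnnihilator_dualCoannihilator_eq]

/-- Functionals on `Λ` and `Λ'` correspond by composition with `φ`, so the same functionals on `V_ℂ`
arise. This is the invariance behind the uniqueness of classifying maps. -/
lemma range_dualMap_of_equiv {Λ' : Type*} [AddCommGroup Λ'] [Module ℂ Λ']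
    (q : (ℂ ⊗[ℝ] V) →ₗ[ℂ] Λ) (q' : (ℂ ⊗[ℝ] V) →ₗ[ℂ] Λ') (φ : Λ ≃ₗ[ℂ] Λ')
    (h : ∀ v, φ (q v) = q' v) : LinearMap.range q.dualMap = LinearMap.range q'.dualMap := by
  ext α
  constructor
  · rintro ⟨l, rfl⟩
    exact ⟨l ∘ₗ φ.symm.toLinearMap, by ext v; simp [← h]⟩
  · rintro ⟨l, rfl⟩
    exact ⟨l ∘ₗ φ.toLinearMap, by ext v; simp [h]⟩

variable [FiniteDimensional ℝ V]

/-- The point of the orthogonal Grassmannian defined by an isotropic quotient of `V_ℂ`: the image of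
the dual embedding. -/
def pointOf (q : (ℂ ⊗[ℝ] V) →ₗ[ℂ] Λ) (hs : Function.Surjective q) (hq : IsIsotropic q)
    (hn : Module.finrank ℂ Λ = n) : OG V n :=
  ⟨LinearMap.range q.dualMap, by
    rw [LinearMap.finrank_range_of_inj (LinearMap.dualMap_injective_of_surjective hs),
      Subspace.dual_finrank_eq, hn], by
    rintro _ ⟨l, rfl⟩ _ ⟨l', rfl⟩
    exact hq l l'⟩

/-- An isotropic quotient of `V_ℂ` is isomorphic to the fibre of the universal bundle at the point
that it defines. -/
def fiberEquiv (q : (ℂ ⊗[ℝ] V) →ₗ[ℂ] Λ) (hs : Function.Surjective q) {W : OG V n}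
    (hW : W.1 = LinearMap.range q.dualMap) : Λ ≃ₗ[ℂ] UnivFiber W :=
  ((Submodule.quotEquivOfEq W.1.dualCoannihilator (LinearMap.ker q)
    (by rw [hW, dualCoannihilator_range_dualMap])).trans
      (q.quotKerEquivOfSurjective hs)).symm

lemma fiberEquiv_apply (q : (ℂ ⊗[ℝ] V) →ₗ[ℂ] Λ) (hs : Function.Surjective q) {W : OG V n}
    (hW : W.1 = LinearMap.range q.dualMap) (v : ℂ ⊗[ℝ] V) :
    fiberEquiv q hs hW (q v) = univQuot W v := by
  refine (LinearEquiv.symm_apply_eq ((Submodule.quotEquivOfEq W.1.dualCoannihilator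
    (LinearMap.ker q) (by rw [hW, dualCoannihilator_range_dualMap])).trans
      (q.quotKerEquivOfSurjective hs))).2 ?_
  rfl

/-- Such a functional kills the common kernel of `W`, and in finite dimension `W` is the whole
annihilator of its common kernel. -/
lemma mem_of_dual_univFiber {W : OG V n} (l : Module.Dual ℂ (UnivFiber W)) :
    l ∘ₗ univQuot W ∈ W.1 := by
  rw [← Subspace.dualCoannihilator_dualAnnihilator_eq (W := W.1),
    Submodule.mem_dualAnnihilator]
  intro v hv
  have : univQuot W v = 0 := (Submodule.Quotient.mk_eq_zero _).2 hv
  rw [LinearMap.comp_apply, this, map_zero]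

/-- A point of the Grassmannian can be recovered from the universal fibre over it: every functional
in `W` descends to the quotient by the common kernel, and nothing else does. -/
lemma range_dualMap_univQuot (W : OG V n) : LinearMap.range (univQuot W).dualMap = W.1 := by
  refine le_antisymm ?_ fun α hα => ?_
  · rintro _ ⟨l, rfl⟩
    exact mem_of_dual_univFiber l
  · refine ⟨Submodule.liftQ _ α fun v hv => ?_, rfl⟩
    exact (Submodule.mem_dualCoannihilator _).1 hv α hα

end Points

/-! ### Real quotients with a complex structure as complex quotients of `V_ℂ` -/

section ComplexStructure

variable {Λ : Type*} [AddCommGroup Λ] [Module ℝ Λ]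

/-- A real vector space with an endomorphism `J` such that `J² = -1`, as a complex vector space. -/
def JSpace (J : Λ →ₗ[ℝ] Λ) (_hJ : ∀ y, J (J y) = -y) : Type _ := Λ

variable (J : Λ →ₗ[ℝ] Λ) (hJ : ∀ y, J (J y) = -y)

instance : AddCommGroup (JSpace J hJ) := inferInstanceAs (AddCommGroup Λ)

instance : Module ℝ (JSpace J hJ) := inferInstanceAs (Module ℝ Λ)

variable {J} in
lemma mul_self_of_sq (hJ : ∀ y, J (J y) = -y) : (J * J : Module.End ℝ Λ) = -1 := LinearMap.ext hJ

/-- As `J` and `hJ` are arguments of the type synonym, this structure is found by instance search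
and `Λ` itself stays a real space, free of any preferred complex structure. -/
instance : Module ℂ (JSpace J hJ) :=
  Module.compHom Λ (Complex.liftAux (A := Module.End ℝ Λ) J (mul_self_of_sq hJ)).toRingHom

/-- The identity, as a real linear map. -/
def toJSpace : Λ ≃ₗ[ℝ] JSpace J hJ := LinearEquiv.refl ℝ Λ

lemma smul_toJSpace (c : ℂ) (y : Λ) :
    c • toJSpace J hJ y = toJSpace J hJ (c.re • y + c.im • J y) := by
  change Complex.liftAux (A := Module.End ℝ Λ) J (mul_self_of_sq hJ) c y = c.re • y + c.im • J y
  rw [Complex.liftAux_apply]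
  simp

lemma I_smul_toJSpace (y : Λ) : Complex.I • toJSpace J hJ y = toJSpace J hJ (J y) := by
  rw [smul_toJSpace]; simp

instance : IsScalarTower ℝ ℂ (JSpace J hJ) where
  smul_assoc a c y := by
    obtain ⟨y, rfl⟩ := (toJSpace J hJ).surjective y
    rw [smul_toJSpace, smul_toJSpace, ← map_smul]
    simp [mul_smul]

lemma finrank_JSpace {n : ℕ} (hn : Module.finrank ℝ Λ = 2 * n) :
    Module.finrank ℂ (JSpace J hJ) = n := by
  have h := Module.finrank_mul_finrank ℝ ℂ (JSpace J hJ)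
  rw [Complex.finrank_real_complex, ← (toJSpace J hJ).finrank_eq, hn] at h
  omega

/-- A real linear functional that commutes with `J` and `i`, as a complex linear functional. -/
def toComplexDual (l : Λ →ₗ[ℝ] ℂ) (hl : ∀ y, l (J y) = Complex.I * l y) :
    Module.Dual ℂ (JSpace J hJ) where
  toFun y := l ((toJSpace J hJ).symm y)
  map_add' y y' := by rw [map_add, map_add]
  map_smul' c y := by
    obtain ⟨y, rfl⟩ := (toJSpace J hJ).surjective y
    rw [smul_toJSpace, LinearEquiv.symm_apply_apply, LinearEquiv.symm_apply_apply, map_add,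
      map_smul, map_smul, hl, RingHom.id_apply]
    conv_rhs => rw [← Complex.re_add_im c]
    simp only [Complex.real_smul, smul_eq_mul]
    ring

lemma dual_toJSpace (l : Module.Dual ℂ (JSpace J hJ)) (y : Λ) :
    l (toJSpace J hJ (J y)) = Complex.I * l (toJSpace J hJ y) := by
  rw [← I_smul_toJSpace, map_smul, smul_eq_mul]

variable {V : Type u} [NormedAddCommGroup V] [InnerProductSpace ℝ V]

/-- The complex linear extension `V_ℂ → (Λ, J)` of a real linear map `V → Λ`. -/
def complexQuot (q : V →ₗ[ℝ] Λ) : (ℂ ⊗[ℝ] V) →ₗ[ℂ] JSpace J hJ :=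
  ((toJSpace J hJ).toLinearMap ∘ₗ q).liftBaseChange ℂ

lemma complexQuot_tmul (q : V →ₗ[ℝ] Λ) (c : ℂ) (v : V) :
    complexQuot J hJ q (c ⊗ₜ v) = c • toJSpace J hJ (q v) := by
  simp [complexQuot]

/-- The pure tensors `1 ⊗ v` already reach everything, since the real quotient map is onto. -/
lemma complexQuot_surjective {q : V →ₗ[ℝ] Λ} (hq : Function.Surjective q) :
    Function.Surjective (complexQuot J hJ q) := by
  intro y
  obtain ⟨v, hv⟩ := hq ((toJSpace J hJ).symm y)
  exact ⟨1 ⊗ₜ v, by rw [complexQuot_tmul, hv, one_smul, LinearEquiv.apply_symm_apply]⟩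

/-- The dual form only evaluates functionals at the vectors `1 ⊗ e_i`. There a complex functional on
`JSpace` composed with the extended quotient agrees with the real functional it restricts to,
composed with `q`. -/
lemma isIsotropic_complexQuot [FiniteDimensional ℝ V] {q : V →ₗ[ℝ] Λ} (hq : IsIsotropicReal q J) :
    IsIsotropic (complexQuot J hJ q) := by
  intro l l'
  have h := hq ((l.restrictScalars ℝ) ∘ₗ (toJSpace J hJ).toLinearMap)
    ((l'.restrictScalars ℝ) ∘ₗ (toJSpace J hJ).toLinearMap)
    (dual_toJSpace J hJ l) (dual_toJSpace J hJ l')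
  rw [dualForm_apply] at h ⊢
  rw [← h]
  refine Finset.sum_congr rfl fun i _ => ?_
  simp [complexQuot_tmul]

end ComplexStructure

/-! ### Maps to the Grassmannian given by local frames -/

section FrameMaps

variable {V : Type u} [NormedAddCommGroup V] [InnerProductSpace ℝ V] [FiniteDimensional ℝ V]
  {n : ℕ}

/-- The family of vectors of `V_ℂ^*` with the given values on an orthonormal basis of `V`. -/
def familyOf (x : Fin n → Fin (Module.finrank ℝ V) → ℂ) (i : Fin n) : CDual V :=
  ((stdOrthonormalBasis ℝ V).toBasis.baseChange ℂ).constr ℂ (x i)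

/-- The vectors `1 ⊗ e_j` form a complex basis of `V_ℂ`, so a family of functionals is the matrix of
its values on them. Regularity of a family thereby becomes regularity of a map to a vector space of
matrices. -/
lemma familyOf_values (A : Fin n → CDual V) :
    familyOf (fun i j => A i (1 ⊗ₜ stdOrthonormalBasis ℝ V j)) = A := by
  ext1 i
  refine cdual_ext fun j => ?_
  have h : (1 : ℂ) ⊗ₜ[ℝ] stdOrthonormalBasis ℝ V j =
    ((stdOrthonormalBasis ℝ V).toBasis.baseChange ℂ) j := by simp
  conv_lhs => rw [h]
  rw [familyOf, Module.Basis.constr_basis]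

lemma contDiff_familyOf (φ : CDual V →ₗ[ℂ] ℂ) (i : Fin n) :
    ContDiff ℂ ω fun x : Fin n → Fin (Module.finrank ℝ V) → ℂ => φ (familyOf x i) := by
  have h : ContDiff ℂ ω fun x : Fin n → Fin (Module.finrank ℝ V) → ℂ => x i :=
    contDiff_apply ℂ _ i
  exact (LinearMap.toContinuousLinearMap (φ ∘ₗ
    (((stdOrthonormalBasis ℝ V).toBasis.baseChange ℂ).constr ℂ).toLinearMap)).contDiff.comp h

variable (b : WittBasis V n)

lemma WittBasis.contDiff_mat_familyOf (i j : Fin n) : ContDiff ℂ ω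
    fun x : Fin n → Fin (Module.finrank ℝ V) → ℂ => b.mat (familyOf x) i j :=
  contDiff_familyOf (b.basis.coord _) i

/-- By Cramer's rule the coordinates are rational in the entries of the matrix, with denominator the
determinant of the `e`-block. -/
lemma WittBasis.contDiffOn_coordOf :
    ContDiffOn ℂ ω (fun x : Fin n → Fin (Module.finrank ℝ V) → ℂ => b.coordOf (familyOf x))
      {x | (b.mat (familyOf x)).det ≠ 0} := by
  have hinv := WittBasis.contDiffOn_inv b.contDiff_mat_familyOf
  have h : ∀ i s, ContDiffOn ℂ ω (fun x : Fin n → Fin (Module.finrank ℝ V) → ℂ =>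
      ∑ l, (b.mat (familyOf x))⁻¹ i l * b.basis.repr (familyOf x l) s)
      {x | (b.mat (familyOf x)).det ≠ 0} := fun i s => ContDiffOn.sum fun l _ =>
    (hinv i l).mul (contDiff_familyOf (b.basis.coord s) l).contDiffOn
  refine ContDiffOn.prodMk ?_ ?_
  · exact (LinearMap.toContinuousLinearMap (WittBasis.skewPart n)).contDiff.comp_contDiffOn
      (contDiffOn_pi.2 fun i => contDiffOn_pi.2 fun j => h i _)
  · exact contDiffOn_pi.2 fun i => contDiffOn_pi.2 fun j => h i _

/-- The inverse of a chart of the atlas, whose target is the entire model space. -/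
lemma WittBasis.contMDiff_param : ContMDiff 𝓘(ℂ, Model n (Module.finrank ℝ V - 2 * n))
    𝓘(ℂ, Model n (Module.finrank ℝ V - 2 * n)) ω b.param :=
  contMDiffOn_univ.1 (contMDiffOn_symm_of_mem_maximalAtlas (e := b.chartHomeo)
    (IsManifold.subset_maximalAtlas b.chartHomeo_mem_atlas))

/-- The span of a family of vectors, in terms of a Witt basis. -/
def WittBasis.spanOf (x : Fin n → Fin (Module.finrank ℝ V) → ℂ) : OG V n :=
  b.param (b.coordOf (familyOf x))

lemma WittBasis.isOpen_det_familyOf :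
    IsOpen {x : Fin n → Fin (Module.finrank ℝ V) → ℂ | (b.mat (familyOf x)).det ≠ 0} :=
  (WittBasis.contDiff_det b.contDiff_mat_familyOf).continuous.isOpen_preimage {0}ᶜ
    isOpen_compl_singleton

/-- No isotropy is required: `coordOf` keeps only the skew part of the `f`-block, so it lands in the
model for every family. The domain is thus open in a vector space and ordinary calculus applies,
although the value is the actual span only for isotropic families. -/
lemma WittBasis.contMDiffAt_spanOf {x : Fin n → Fin (Module.finrank ℝ V) → ℂ}
    (hx : (b.mat (familyOf x)).det ≠ 0) :
    ContMDiffAt 𝓘(ℂ, Fin n → Fin (Module.finrank ℝ V) → ℂ)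
      𝓘(ℂ, Model n (Module.finrank ℝ V - 2 * n)) ω b.spanOf x :=
  (b.contMDiff_param _).comp x
    (b.contDiffOn_coordOf.contDiffAt (b.isOpen_det_familyOf.mem_nhds hx)).contMDiffAt

/-- A holomorphic map is smooth as a map of real manifolds. -/
lemma contMDiffAt_real {E F M N : Type*} [NormedAddCommGroup E] [NormedSpace ℂ E] [NormedSpace ℝ E]
    [IsScalarTower ℝ ℂ E] [NormedAddCommGroup F] [NormedSpace ℂ F] [NormedSpace ℝ F]
    [IsScalarTower ℝ ℂ F] [TopologicalSpace M] [ChartedSpace E M] [TopologicalSpace N]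
    [ChartedSpace F N] {f : M → N} {x : M} (h : ContMDiffAt 𝓘(ℂ, E) 𝓘(ℂ, F) ω f x) :
    ContMDiffAt 𝓘(ℝ, E) 𝓘(ℝ, F) ∞ f x := by
  rw [contMDiffAt_iff] at h ⊢
  exact ⟨h.1, (h.2.restrict_scalars ℝ).of_le le_top⟩

/-- The determinant of the `e`-block stays nonzero near `x₀` by continuity. Where it is nonzero, a
family contained in the isotropic subspace `f x` has `f x` as its span, and `param_coordOf` recovers
that subspace. -/
lemma WittBasis.eventuallyEq_spanOf {M : Type*} [TopologicalSpace M] {f : M → OG V n} {x₀ : M}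
    {A : M → Fin n → CDual V} (hA : ∀ᶠ x in nhds x₀, ∀ i, A x i ∈ (f x).1)
    (hdet : (b.mat (A x₀)).det ≠ 0) (hc : ContinuousAt
      (fun x i j => A x i (1 ⊗ₜ stdOrthonormalBasis ℝ V j)) x₀) :
    f =ᶠ[nhds x₀] fun x => b.spanOf fun i j => A x i (1 ⊗ₜ stdOrthonormalBasis ℝ V j) := by
  filter_upwards [hA, hc.preimage_mem_nhds (b.isOpen_det_familyOf.mem_nhds
    (by rw [Set.mem_ofPred_eq, familyOf_values]; exact hdet))] with x hx hx'
  rw [Set.mem_preimage, Set.mem_ofPred_eq, familyOf_values] at hx'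
  rw [WittBasis.spanOf, familyOf_values, b.param_coordOf hx hx']

/-- A map to the orthogonal Grassmannian is holomorphic if it has holomorphic local frames. -/
lemma contMDiffAt_of_frame {N : ComplexMfld.{u}} {f : N.carrier → OG V n} {x₀ : N.carrier}
    {A : N.carrier → Fin n → CDual V} (hA : ∀ᶠ x in nhds x₀, ∀ i, A x i ∈ (f x).1)
    (hli : LinearIndependent ℂ (A x₀))
    (hs : ∀ i v, ContMDiffAt 𝓘(ℂ, N.model) 𝓘(ℂ, ℂ) ω (fun x => A x i (1 ⊗ₜ v)) x₀) :
    ContMDiffAt 𝓘(ℂ, N.model) 𝓘(ℂ, Model n (Module.finrank ℝ V - 2 * n)) ω f x₀ := by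
  set b := wittBasisAt (f x₀)
  -- The chart is centred at `f x₀`, so independence at `x₀` alone makes the determinant nonzero;
  -- independence at nearby points need not be assumed.
  have hdet : (b.mat (A x₀)).det ≠ 0 :=
    b.det_ne_zero_of_mem hli hA.self_of_nhds (mem_chart_wittBasisAt _)
  have hx : ContMDiffAt 𝓘(ℂ, N.model) 𝓘(ℂ, Fin n → Fin (Module.finrank ℝ V) → ℂ) ω
      (fun x i j => A x i (1 ⊗ₜ stdOrthonormalBasis ℝ V j)) x₀ :=
    contMDiffAt_pi_space.2 fun i => contMDiffAt_pi_space.2 fun j => hs i _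
  refine ContMDiffAt.congr_of_eventuallyEq ?_ (b.eventuallyEq_spanOf hA hdet hx.continuousAt)
  exact (b.contMDiffAt_spanOf (by rw [familyOf_values]; exact hdet)).comp x₀ hx

/-- A map to the orthogonal Grassmannian is smooth if it has smooth local frames. -/
lemma contMDiffAt_real_of_frame {M : RealMfld.{u}} {f : M.carrier → OG V n} {x₀ : M.carrier}
    {A : M.carrier → Fin n → CDual V} (hA : ∀ᶠ x in nhds x₀, ∀ i, A x i ∈ (f x).1)
    (hli : LinearIndependent ℂ (A x₀))
    (hs : ∀ i v, ContMDiffAt 𝓘(ℝ, M.model) 𝓘(ℝ, ℂ) ∞ (fun x => A x i (1 ⊗ₜ v)) x₀) :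
    ContMDiffAt 𝓘(ℝ, M.model) 𝓘(ℝ, (grassmannian V n).real.model) ∞
      (fun x => (f x : (grassmannian V n).real.carrier)) x₀ := by
  set b := wittBasisAt (f x₀)
  have hdet : (b.mat (A x₀)).det ≠ 0 :=
    b.det_ne_zero_of_mem hli hA.self_of_nhds (mem_chart_wittBasisAt _)
  have hx : ContMDiffAt 𝓘(ℝ, M.model) 𝓘(ℝ, Fin n → Fin (Module.finrank ℝ V) → ℂ) ∞
      (fun x i j => A x i (1 ⊗ₜ stdOrthonormalBasis ℝ V j)) x₀ :=
    contMDiffAt_pi_space.2 fun i => contMDiffAt_pi_space.2 fun j => hs i _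
  refine ContMDiffAt.congr_of_eventuallyEq ?_ (b.eventuallyEq_spanOf hA hdet hx.continuousAt)
  -- The real structure by which `Mfld.real` restricts scalars. The span map is holomorphic and
  -- hence smooth; it is only the family that is merely smooth.
  let : NormedSpace ℝ (grassmannian V n).model := NormedSpace.complexToReal
  exact (contMDiffAt_real (b.contMDiffAt_spanOf
    (by rw [familyOf_values]; exact hdet))).comp x₀ hx

end FrameMaps

lemma QuotientBundle.finrank_fiber {𝕜 : Type} [NontriviallyNormedField 𝕜] {k : WithTop ℕ∞}
    {M : Mfld.{u} 𝕜 k} {X : Type u} [AddCommGroup X] [Module 𝕜 X] {r : ℕ}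
    (E : QuotientBundle M X r) (x : M.carrier) : Module.finrank 𝕜 (E.fiber x) = r := by
  rw [((trivializationAt E.fiberModel E.fiber x).linearEquivAt 𝕜 x
    (FiberBundle.mem_baseSet_trivializationAt' x)).finrank_eq, E.finrank_eq]

variable {V : Type u} [NormedAddCommGroup V] [InnerProductSpace ℝ V] [FiniteDimensional ℝ V]
  {n : ℕ}

/-- The dual basis, carried into the dual of `X` by the transpose of `q`, which is injective because
`q` is onto. -/
lemma linearIndependent_coord_comp {X Λ : Type*} [AddCommGroup X] [Module ℂ X] [AddCommGroup Λ]
    [Module ℂ Λ] {q : X →ₗ[ℂ] Λ} (hq : Function.Surjective q) (B : Module.Basis (Fin n) ℂ Λ) :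
    LinearIndependent ℂ fun i => B.coord i ∘ₗ q :=
  (B.coe_dualBasis ▸ B.dualBasis.linearIndependent).map' q.dualMap
    (LinearMap.ker_eq_bot.2 (LinearMap.dualMap_injective_of_surjective hq))

/-! ### Classifying maps of isotropic holomorphic quotient bundles -/

namespace HolomorphicIsotropicQuotient

variable {N : ComplexMfld.{u}} (E : HolomorphicIsotropicQuotient V n N)

/-- The point of the orthogonal Grassmannian defined by a fibre. -/
def point (x : N.carrier) : OG V n :=
  pointOf (E.quot x) (E.quot_surjective x) (E.isotropic x) (E.finrank_fiber x)

/-- The coordinates of the quotient map in a local trivialization are functionals on `V_ℂ` that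
frame the image of the dual embedding, and their values on constant vectors are coordinates of
holomorphic sections. -/
lemma contMDiff_point : ContMDiff 𝓘(ℂ, N.model) 𝓘(ℂ, Model n (Module.finrank ℝ V - 2 * n)) ω
    E.point := by
  intro x₀
  let B := Module.finBasisOfFinrankEq ℂ E.fiberModel E.finrank_eq
  refine contMDiffAt_of_frame (A := fun x i => B.coord i ∘ₗ E.localQuot x₀ x)
    -- The trivialization enters through `linearMapAt`, which is a linear map on every fibre (zero
    -- outside the base set), so each member of the family factors through `E.quot x` for all `x`.
    (Filter.Eventually.of_forall fun x i => ⟨B.coord i ∘ₗ _, rfl⟩)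
    (linearIndependent_coord_comp (E.localQuot_surjective
      (FiberBundle.mem_baseSet_trivializationAt' x₀)) B) fun i v => ?_
  exact ((LinearMap.toContinuousLinearMap (B.coord i)).contDiff.contMDiff.contMDiffAt).comp x₀
    (E.contMDiffAt_localQuot x₀ _)

/-- The classifying map of an isotropic holomorphic quotient bundle. -/
def classifying : N ⟶ grassmannian V n := ⟨E.point, E.contMDiff_point⟩

/-- Both fibres at `x` are quotients of `V_ℂ` by the kernel of `E.quot x`; holomorphy of the
resulting isomorphism comes for free from `Iso.ofEquiv`. -/
lemma isomorphic_classifying :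
    E.Isomorphic ((universalHolomorphic V n).pullback E.classifying) :=
  ⟨QuotientBundle.Iso.ofEquiv (E' := ((universalHolomorphic V n).pullback
      E.classifying).toQuotientBundle)
    (fun x => fiberEquiv (W := E.point x) (E.quot x) (E.quot_surjective x) rfl)
    (fun x v => fiberEquiv_apply (W := E.point x) (E.quot x) (E.quot_surjective x) rfl v)⟩

variable {E} in
-- The isomorphism identifies the image of the dual embedding of `E_x` with that of the universal
-- fibre over `f x`, which is `f x`.
lemma eq_classifying {f : N ⟶ grassmannian V n}
    (h : E.Isomorphic ((universalHolomorphic V n).pullback f)) : f = E.classifying := by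
  obtain ⟨φ⟩ := h
  refine ContMDiffMap.ext fun x => Subtype.ext ?_
  rw [← range_dualMap_univQuot (Mfld.map f x)]
  exact (range_dualMap_of_equiv (E.quot x) (univQuot (Mfld.map f x)) (φ.equiv x)
    (φ.equiv_quot x)).symm

lemma existsUnique_classifying :
    ∃! f : N ⟶ grassmannian V n, E.Isomorphic ((universalHolomorphic V n).pullback f) :=
  ⟨E.classifying, E.isomorphic_classifying, fun _ h => eq_classifying h⟩

end HolomorphicIsotropicQuotient

/-! ### Classifying maps of almost-complex isotropic quotient bundles -/

namespace AlmostComplexIsotropicQuotient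

variable {M : RealMfld.{u}} (E : AlmostComplexIsotropicQuotient V n M)

/-- The quotient `V_ℂ → (E_x, J_x)`. -/
def quotC (x : M.carrier) : (ℂ ⊗[ℝ] V) →ₗ[ℂ] JSpace (E.J x) (E.J_sq x) :=
  complexQuot (E.J x) (E.J_sq x) (E.quot x)

lemma quotC_surjective (x : M.carrier) : Function.Surjective (E.quotC x) :=
  complexQuot_surjective _ _ (E.quot_surjective x)

lemma quotC_one_tmul (x : M.carrier) (v : V) :
    E.quotC x (1 ⊗ₜ v) = toJSpace (E.J x) (E.J_sq x) (E.quot x v) := by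
  rw [quotC, complexQuot_tmul, one_smul]

lemma finrank_JSpace_fiber (x : M.carrier) :
    Module.finrank ℂ (JSpace (E.J x) (E.J_sq x)) = n :=
  finrank_JSpace _ _ (E.finrank_fiber x)

/-- The point of the orthogonal Grassmannian defined by a fibre. -/
def point (x : M.carrier) : OG V n :=
  pointOf (E.quotC x) (E.quotC_surjective x) (isIsotropic_complexQuot _ _ (E.isotropic x))
    (E.finrank_JSpace_fiber x)

/-- The `J`-linear part of a real linear functional. -/
def linearPart {Λ : Type*} [AddCommGroup Λ] [Module ℝ Λ] (J : Λ →ₗ[ℝ] Λ)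
    (hJ : ∀ y, J (J y) = -y) (l : Λ →ₗ[ℝ] ℂ) : Module.Dual ℂ (JSpace J hJ) :=
  -- Averaging `l` with `-i l ∘ J` gives a `J`-linear functional, and the factor one half makes the
  -- operation the identity on functionals that are `J`-linear already.
  toComplexDual J hJ ((2⁻¹ : ℂ) • (l - Complex.I • (l ∘ₗ J))) fun y => by
    simp only [LinearMap.smul_apply, LinearMap.sub_apply, LinearMap.comp_apply, hJ, map_neg,
      smul_eq_mul]
    linear_combination (2⁻¹ * l (J y)) * Complex.I_sq

lemma linearPart_apply {Λ : Type*} [AddCommGroup Λ] [Module ℝ Λ] (J : Λ →ₗ[ℝ] Λ)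
    (hJ : ∀ y, J (J y) = -y) (l : Λ →ₗ[ℝ] ℂ) (y : Λ) :
    linearPart J hJ l (toJSpace J hJ y) = 2⁻¹ * (l y - Complex.I * l (J y)) := rfl

/-- The `J`-linear part of a functional involves its value at `J (q v)`, so this section has to be
smooth as well as `q v`. -/
lemma contMDiffAt_J_quot (x₀ : M.carrier) (v : V) :
    ContMDiffAt 𝓘(ℝ, M.model) 𝓘(ℝ, E.fiberModel) ∞ (fun x =>
      (trivializationAt E.fiberModel E.fiber x₀).linearMapAt ℝ x (E.J x (E.quot x v))) x₀ := by
  have h : ContMDiff 𝓘(ℝ, M.model) (𝓘(ℝ, M.model).prod 𝓘(ℝ, E.fiberModel)) ∞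
      (fun x => TotalSpace.mk' E.fiberModel x (E.J x (E.quot x v))) :=
    E.contMDiff_J.comp (E.contMDiff_quot v)
  refine ((contMDiffAt_section x₀).1 (h x₀)).congr_of_eventuallyEq ?_
  filter_upwards [E.baseSet_mem_nhds x₀] with x hx
  rw [(trivializationAt E.fiberModel E.fiber x₀).linearMapAt_apply, if_pos hx]

/-- A trivialization need not carry `J_x` to a constant endomorphism, so functionals constant in it
are not complex linear on nearby fibres. Starting from a complex dual basis at `x₀`, the functionals
are extended constantly in the trivialization and replaced by their `J_x`-linear parts. The
projection changes nothing at `x₀`, so independence holds there, which is all that the frame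
criterion requires. -/
lemma contMDiff_point : ContMDiff 𝓘(ℝ, M.model) 𝓘(ℝ, (grassmannian V n).real.model) ∞
    (fun x => (E.point x : (grassmannian V n).real.carrier)) := by
  intro x₀
  set e := trivializationAt E.fiberModel E.fiber x₀
  have hx₀ : x₀ ∈ e.baseSet := FiberBundle.mem_baseSet_trivializationAt' x₀
  have : Module.Finite ℂ (JSpace (E.J x₀) (E.J_sq x₀)) :=
    Module.Finite.of_surjective (E.quotC x₀) (E.quotC_surjective x₀)
  let B := Module.finBasisOfFinrankEq ℂ (JSpace (E.J x₀) (E.J_sq x₀))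
    (E.finrank_JSpace_fiber x₀)
  -- The complex dual basis at `x₀`, viewed as real functionals on the model fibre, so that it can
  -- be applied in other fibres through the trivialization.
  let l : Fin n → E.fiberModel →ₗ[ℝ] ℂ := fun i => ((B.coord i).restrictScalars ℝ) ∘ₗ
    (toJSpace (E.J x₀) (E.J_sq x₀)).toLinearMap ∘ₗ (e.linearEquivAt ℝ x₀ hx₀).symm.toLinearMap
  have hl : ∀ i y, l i (e.linearMapAt ℝ x₀ y) = B.coord i (toJSpace _ _ y) := by
    intro i y
    have : e.linearMapAt ℝ x₀ y = e.linearEquivAt ℝ x₀ hx₀ y := by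
      rw [e.linearMapAt_apply, if_pos hx₀]; rfl
    rw [this]
    simp only [l, LinearMap.comp_apply, LinearEquiv.coe_coe, LinearEquiv.symm_apply_apply]
    rfl
  clear_value l
  let A : M.carrier → Fin n → CDual V := fun x i =>
    linearPart (E.J x) (E.J_sq x) (l i ∘ₗ e.linearMapAt ℝ x) ∘ₗ E.quotC x
  have hA₀ : A x₀ = fun i => B.coord i ∘ₗ E.quotC x₀ := by
    ext1 i
    have : linearPart (E.J x₀) (E.J_sq x₀) (l i ∘ₗ e.linearMapAt ℝ x₀) = B.coord i := by
      refine LinearMap.ext fun y => ?_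
      obtain ⟨y, rfl⟩ := (toJSpace (E.J x₀) (E.J_sq x₀)).surjective y
      rw [linearPart_apply, LinearMap.comp_apply, LinearMap.comp_apply, hl, hl, dual_toJSpace]
      linear_combination (-2⁻¹ * B.coord i (toJSpace _ _ y)) * Complex.I_sq
    simp only [A, this]
  refine contMDiffAt_real_of_frame (A := A)
    (Filter.Eventually.of_forall fun x i =>
      ⟨linearPart (E.J x) (E.J_sq x) (l i ∘ₗ e.linearMapAt ℝ x), rfl⟩)
    (hA₀ ▸ linearIndependent_coord_comp (E.quotC_surjective x₀) B) fun i v => ?_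
  -- Written out, each value is a fixed real-linear expression in the smooth local sections `q v`
  -- and `J (q v)`.
  have hval : ∀ x, A x i (1 ⊗ₜ v) = 2⁻¹ * (l i (E.localQuot x₀ x v) -
      Complex.I * l i (e.linearMapAt ℝ x (E.J x (E.quot x v)))) := by
    intro x
    simp only [A, LinearMap.comp_apply, quotC_one_tmul, linearPart_apply]
    rfl
  simp only [hval]
  have hli := (LinearMap.toContinuousLinearMap (l i)).contDiff (n := ∞).contMDiff
  have h1 := hli.contMDiffAt.comp x₀ (E.contMDiffAt_localQuot x₀ v)
  have h2 := hli.contMDiffAt.comp x₀ (E.contMDiffAt_J_quot x₀ v)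
  have hg : ContDiff ℝ ∞ fun z : ℂ × ℂ => 2⁻¹ * (z.1 - Complex.I * z.2) := by fun_prop
  exact hg.contMDiff.contMDiffAt.comp x₀ (h1.prodMk_space h2)

/-- The classifying map of an almost-complex isotropic quotient bundle. -/
def classifying : M ⟶ (grassmannian V n).real := ⟨E.point, E.contMDiff_point⟩

/-- The isomorphism of a fibre with the fibre of the universal bundle. -/
def fiberEquivReal (x : M.carrier) :
    E.fiber x ≃ₗ[ℝ] ((universalReal V n).pullback E.classifying).fiber x :=
  let φ := fiberEquiv (W := E.point x) (E.quotC x) (E.quotC_surjective x) rfl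
  { toFun := fun y => φ (toJSpace (E.J x) (E.J_sq x) y)
    invFun := fun y => (toJSpace (E.J x) (E.J_sq x)).symm (φ.symm y)
    map_add' := fun y z => by rw [map_add]; exact map_add φ _ _
    map_smul' := fun c y => by
      -- Real scalars act on both sides through `ℂ`, so complex linearity of `φ` yields real
      -- linearity.
      have h : toJSpace (E.J x) (E.J_sq x) (c • y) = (c : ℂ) • toJSpace (E.J x) (E.J_sq x) y := by
        rw [smul_toJSpace]; simp
      rw [h]
      exact map_smul φ (c : ℂ) _
    left_inv := fun y => by
      rw [LinearEquiv.symm_apply_eq]; exact φ.symm_apply_apply _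
    right_inv := fun y => φ.apply_symm_apply y }

/-- Compatibility with the real quotient maps is that of `fiberEquiv` at the tensors `1 ⊗ v`.
Compatibility with the almost complex structures is its complex linearity, as `i` acts on the source
through `J`. -/
lemma isomorphic_classifying :
    E.Isomorphic ((universalReal V n).pullback E.classifying) := by
  refine ⟨QuotientBundle.Iso.ofEquiv E.fiberEquivReal fun x v => ?_, fun x y => ?_⟩
  · have h := fiberEquiv_apply (W := E.point x) (E.quotC x) (E.quotC_surjective x) rfl (1 ⊗ₜ v)
    rw [quotC_one_tmul] at h
    exact h
  · change fiberEquiv (W := E.point x) (E.quotC x) (E.quotC_surjective x) rfl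
      (toJSpace (E.J x) (E.J_sq x) (E.J x y)) = Complex.I •
        fiberEquiv (W := E.point x) (E.quotC x) (E.quotC_surjective x) rfl
          (toJSpace (E.J x) (E.J_sq x) y)
    rw [← I_smul_toJSpace, map_smul]

/-- A real linear isomorphism of `(Λ, J)` with a complex vector space that commutes with the complex
structures, as a complex linear isomorphism. -/
def complexEquiv {Λ Λ' : Type*} [AddCommGroup Λ] [Module ℝ Λ] [AddCommGroup Λ'] [Module ℂ Λ']
    (J : Λ →ₗ[ℝ] Λ) (hJ : ∀ y, J (J y) = -y) (φ : Λ ≃+ Λ')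
    (hφ : ∀ (c : ℝ) y, φ (c • y) = (c : ℂ) • φ y) (h : ∀ y, φ (J y) = Complex.I • φ y) :
    JSpace J hJ ≃ₗ[ℂ] Λ' :=
  { (toJSpace J hJ).symm.toAddEquiv.trans φ with
    map_smul' := fun c y => by
      obtain ⟨y, rfl⟩ := (toJSpace J hJ).surjective y
      rw [smul_toJSpace]
      change φ (c.re • y + c.im • J y) = c • φ y
      rw [map_add, hφ, hφ, h, smul_smul, ← add_smul, Complex.re_add_im] }

variable {E} in
-- Commuting with the almost complex structures makes the fibre isomorphism complex linear on
-- `JSpace`. It respects the quotient maps on `V`, hence on the complex span `V_ℂ`, and the argument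
-- of the holomorphic case applies.
lemma eq_classifying {f : M ⟶ (grassmannian V n).real}
    (h : E.Isomorphic ((universalReal V n).pullback f)) : f = E.classifying := by
  obtain ⟨φ, hφ⟩ := h
  refine ContMDiffMap.ext fun x => Subtype.ext ?_
  let W : OG V n := Mfld.map f x
  change W.1 = (E.point x).1
  rw [← range_dualMap_univQuot W]
  -- Only the additive map is kept, so that the target can be taken with its complex structure; the
  -- real scalars of the pulled-back fibre are the restriction of that structure.
  let ψ : E.fiber x ≃+ UnivFiber W := (φ.equiv x).toAddEquiv
  let Ψ : JSpace (E.J x) (E.J_sq x) ≃ₗ[ℂ] UnivFiber W := complexEquiv (E.J x) (E.J_sq x) ψ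
    (fun c y => (φ.equiv x).map_smul c y) (hφ x)
  have hΨ : Ψ.toLinearMap ∘ₗ E.quotC x = univQuot W := by
    -- Complex linear maps out of `ℂ ⊗ V` are determined by their values at `1 ⊗ v`.
    refine TensorProduct.AlgebraTensorModule.curry_injective
      (LinearMap.ext_ring (LinearMap.ext fun v => ?_))
    change Ψ (E.quotC x (1 ⊗ₜ v)) = univQuot W (1 ⊗ₜ v)
    rw [quotC_one_tmul]
    exact φ.equiv_quot x v
  exact (range_dualMap_of_equiv (E.quotC x) (univQuot W) Ψ (LinearMap.congr_fun hΨ)).symm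

lemma existsUnique_classifying :
    ∃! f : M ⟶ (grassmannian V n).real, E.Isomorphic ((universalReal V n).pullback f) :=
  ⟨E.classifying, E.isomorphic_classifying, fun _ h => eq_classifying h⟩

end AlmostComplexIsotropicQuotient

/-! ### From unique classifying maps to representability -/

/-- An element of a presheaf of which every other element is the image under exactly one morphism
is universal. -/
lemma exists_representableBy {C : Type*} [Category C] (F : Cᵒᵖ ⥤ Type*) {Y : C}
    (u : F.obj (Opposite.op Y))
    (h : ∀ (X : C) (c : F.obj (Opposite.op X)), ∃! f : X ⟶ Y, F.map f.op u = c) :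
    ∃ r : F.RepresentableBy Y, r.homEquiv (𝟙 Y) = u := by
  -- The Yoneda map of `u` is bijective on each object by hypothesis, and its naturality is
  -- functoriality of `F`.
  refine ⟨{ homEquiv := fun {X} => Equiv.ofBijective (fun f : X ⟶ Y => F.map f.op u)
              ((Function.bijective_iff_existsUnique _).2 (h X))
            homEquiv_comp := fun f g => ?_ }, ?_⟩
  · simp
  · simp

end OrthogonalGrassmannian

end

open OrthogonalGrassmannian in
theorem mainTheorem3 (V : Type*) [NormedAddCommGroup V] [InnerProductSpace ℝ V]
    [FiniteDimensional ℝ V] (n : ℕ) (hn : 1 ≤ n) (hm : 2 * n ≤ Module.finrank ℝ V) :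
    (∃ r : (AlmostComplexIsotropicQuotient.isoClasses V n).RepresentableBy (grassmannian V n).real,
      r.homEquiv (𝟙 (grassmannian V n).real) = (universalReal V n).isoClass) ∧
    (∃ r : (HolomorphicIsotropicQuotient.isoClasses V n).RepresentableBy (grassmannian V n),
      r.homEquiv (𝟙 (grassmannian V n)) = (universalHolomorphic V n).isoClass) ∧
    (∀ (M : RealMfld) (E : AlmostComplexIsotropicQuotient V n M),
      ∃! f : M ⟶ (grassmannian V n).real, E.Isomorphic ((universalReal V n).pullback f)) ∧
    (∀ (N : ComplexMfld) (E : HolomorphicIsotropicQuotient V n N),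
      ∃! f : N ⟶ grassmannian V n, E.Isomorphic ((universalHolomorphic V n).pullback f)) := by
  refine ⟨exists_representableBy _ _ fun M c => ?_, exists_representableBy _ _ fun N c => ?_,
    fun M E => E.existsUnique_classifying, fun N E => E.existsUnique_classifying⟩
  · induction c using Quotient.inductionOn with
    | h E =>
      refine (existsUnique_congr fun f => ?_).1 E.existsUnique_classifying
      -- Equality of classes is isomorphism of representatives. The symmetry is needed because the
      -- pullback is on the left in the equation of classes and on the right in `Isomorphic`.
      exact ⟨fun h => (Quotient.sound h).symm, fun h => Quotient.exact h.symm⟩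
  · induction c using Quotient.inductionOn with
    | h E =>
      refine (existsUnique_congr fun f => ?_).1 E.existsUnique_classifying
      exact ⟨fun h => (Quotient.sound h).symm, fun h => Quotient.exact h.symm⟩
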